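/- Let $-\infty\le a<b\le\infty$, let $q\in L^1_{\mathrm{loc}}(a,b)$ be real-valued, $\tau=-\frac{d^2}{dx^2}+q$, and let $H$ be a self-adjoint operator in $L^2(a,b)$ given by $\tau$ with separated boundary conditions. Write $W_x(f,g)=f(x)g'(x)-f'(x)g(x)$, and $W_a$, $W_b$ for its limits as $x\downarrow a$, $x\uparrow b$. A function is in the domain of $H$ near an endpoint if it coincides near that endpoint with an element of the domain of $H$. An entire solution is a family $u(z,\cdot)$, $z\in\mathbb C$, with $\tau u(z,\cdot)=z\,u(z,\cdot)$ and with $u(z,x)$, $u'(z,x)$ entire in $z$ for each $x\in(a,b)$. Assume the following. (i) The spectrum of $H$ is purely discrete, and $\phi(z,x)$, $\chi(z,x)$ are entire solutions, $\chi$ not identically zero, such that for every $z\in\mathbb C$ the function $\phi(z,\cdot)$ is in the domain of $H$ near $a$ and $\chi(z,\cdot)$ is in the domain of $H$ near $b$. Put $W(z)=W_x(\phi(z),\chi(z))$, which does not depend on $x$. (ii) For every compact $K\subset\mathbb C\times\rho(H)$ there is $F\in L^1(a,b)$ with $|\phi(w,x)\chi(z,x)|\le F(x)$ for all $(w,z)\in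 K$ and $x\in(a,b)$. (iii) For all $w\in\mathbb C$ and $z\in\rho(H)$, $\lim_{x\downarrow a}W_x(\phi(w),\chi(z))=W(z)$ and $\lim_{x\uparrow b}W_x(\phi(w),\chi(z))=W(w)$. Let further $\theta(z,x)$ be an entire solution with $W_x(\theta(z),\phi(z))= 1$ for all $z\in\mathbb C$ and $x\in(a,b)$, let $M(z)$ be the singular Weyl function, that is, for every $z\in\rho(H)$ the function $\psi(z,x)=\theta(z,x)+M(z)\phi(z,x)$ is in the domain of $H$ near $b$, and write $\psi^{(j)}(z,x)=\frac{\partial^j}{\partial z^j}\psi(z,x)$. Then $\psi(z,x)$ is holomorphic in $z\in\rho(H)$ for every $x\in(a,b)$, each $\psi^{(j)}(z,\cdot)$ is differentiable on $(a,b)$, and for all $w\in\mathbb C$, $z\in\rho(H)$ and $j\ge0$ the function $\phi(w,\cdot)\psi^{(j)}(z,\cdot)$ is integrable over $(a,b)$, the limits $W_b(\psi^{(k)}(z),\phi(w))$, $k\ge 0$, exist, and $$\frac{(w-z)^{j+1}}{j!}\int_a^b\phi(w,x)\,\psi^{(j)}(z,x)\,dx=1-\sum_{k=0}^{j}\frac{(w-z)^k}{k!}\,W_b\big(\psi^{(k)}(z),\phi(w)\big).$$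 Consequently, for every $\lambda\in\sigma(H)$, $z\in\rho(H)$ and $j\ge0$, $$\int_a^b\phi(\lambda,x)\,\psi^{(j)}(z,x)\,dx=\frac{j!}{(\lambda-z)^{j+1}}.$$ -/

import Mathlib

open MeasureTheory Filter Topology

noncomputable section

namespace SingularWeyl

/-- The open interval `(a, b)` of the real line, with `-∞ ≤ a` and `b ≤ ∞`. -/
def interval (a b : EReal) : Set ℝ := {x | a < (x : EReal) ∧ (x : EReal) < b}

/-- The filter "`x ↓ a`". -/
def toLeft (a : EReal) : Filter ℝ := comap Real.toEReal (𝓝[>] a)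

/-- The filter "`x ↑ b`". -/
def toRight (b : EReal) : Filter ℝ := comap Real.toEReal (𝓝[<] b)

/-- Lebesgue measure on `(a, b)`. -/
abbrev leb (a b : EReal) : Measure ℝ := volume.restrict (interval a b)

/-- The Hilbert space `L²(a, b)`. -/
abbrev L2 (a b : EReal) : Type := Lp ℂ 2 (leb a b)

/-- The Wronskian `W_x(f, g) = f(x) g'(x) - f'(x) g(x)`. -/
def wronskian (f g : ℝ → ℂ) (x : ℝ) : ℂ := f x * deriv g x - deriv f x * g x

/-- The differential expression `τ f = -f'' + q f`. -/
def tau (q : ℝ → ℝ) (f : ℝ → ℂ) (x : ℝ) : ℂ := -deriv (deriv f) x + (q x : ℂ) * f x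

/-- `f` is differentiable on `(a, b)` and `f'` is locally absolutely continuous there
(so that `f` is locally absolutely continuous, too). -/
structure LocACDeriv (a b : EReal) (f : ℝ → ℂ) : Prop where
  differentiableAt : ∀ x ∈ interval a b, DifferentiableAt ℝ f x
  ac_deriv : ∀ c ∈ interval a b, ∀ d ∈ interval a b,
    AbsolutelyContinuousOnInterval (deriv f) c d

/-- `u` is a solution of `τ u = z u` on `(a, b)`. -/
structure IsSolution (a b : EReal) (q : ℝ → ℝ) (z : ℂ) (u : ℝ → ℂ) : Prop where
  locAC : LocACDeriv a b u
  eqn : ∀ᵐ x ∂(leb a b), tau q u x = z * u x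

/-- `z ↦ u(z, ·)` is an entire solution: for every `z` it solves `τ u = z u`, and
`u(z, x)` and `u'(z, x)` are entire in `z` for every `x`. -/
structure IsEntireSolution (a b : EReal) (q : ℝ → ℝ) (u : ℂ → ℝ → ℂ) : Prop where
  solution : ∀ z, IsSolution a b q z (u z)
  entire : ∀ x ∈ interval a b, Differentiable ℂ (fun z => u z x)
  entire_deriv : ∀ x ∈ interval a b, Differentiable ℂ (fun z => deriv (u z) x)

/-- The domain of the maximal operator: `f, f'` are locally absolutely continuous and
`f, τ f` are square integrable. -/
structure MaxDomain (a b : EReal) (q : ℝ → ℝ) (f : ℝ → ℂ) : Prop where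
  locAC : LocACDeriv a b f
  memLp : MemLp f 2 (leb a b)
  memLp_tau : MemLp (tau q f) 2 (leb a b)

/-- `H` is a self-adjoint operator in `L²(a, b)` given by `τ` with separated boundary
conditions `W_a(v, f) = 0` and `W_b(u, f) = 0`. At an endpoint in the limit point case the
condition is void. -/
structure IsSeparatedRealization (a b : EReal) (q : ℝ → ℝ)
    (H : L2 a b →ₗ.[ℂ] L2 a b) : Prop where
  selfAdjoint : IsSelfAdjoint H
  domain : ∃ v u : ℝ → ℂ, MaxDomain a b q v ∧ MaxDomain a b q u ∧
    Tendsto (wronskian v (fun x => star (v x))) (toLeft a) (𝓝 0) ∧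
    Tendsto (wronskian u (fun x => star (u x))) (toRight b) (𝓝 0) ∧
    ∀ f : L2 a b, f ∈ H.domain ↔ ∃ g : ℝ → ℂ, MaxDomain a b q g ∧ f =ᵐ[leb a b] g ∧
      Tendsto (wronskian v g) (toLeft a) (𝓝 0) ∧ Tendsto (wronskian u g) (toRight b) (𝓝 0)
  apply : ∀ (f : H.domain) (g : ℝ → ℂ), MaxDomain a b q g → (f : L2 a b) =ᵐ[leb a b] g →
    H f =ᵐ[leb a b] tau q g

/-- The resolvent set `ρ(H)`: those `z` for which `H - z` has an everywhere defined bounded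
inverse. -/
def resolventSet {a b : EReal} (H : L2 a b →ₗ.[ℂ] L2 a b) : Set ℂ :=
  {z | ∃ R : L2 a b →L[ℂ] L2 a b,
    (∀ g, ∃ h : R g ∈ H.domain, H ⟨R g, h⟩ - z • R g = g) ∧
    ∀ f : H.domain, R (H f - z • (f : L2 a b)) = f}

/-- The spectrum `σ(H)`. -/
def spectrum {a b : EReal} (H : L2 a b →ₗ.[ℂ] L2 a b) : Set ℂ := (resolventSet H)ᶜ

/-- The spectrum of `H` is purely discrete: it consists of isolated eigenvalues of finite
multiplicity. -/
def PurelyDiscrete {a b : EReal} (H : L2 a b →ₗ.[ℂ] L2 a b) : Prop :=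
  ∀ z ∈ spectrum H, (∀ᶠ ζ in 𝓝[≠] z, ζ ∈ resolventSet H) ∧
    LinearMap.ker (H.toFun - z • H.domain.subtype) ≠ ⊥ ∧
    FiniteDimensional ℂ (LinearMap.ker (H.toFun - z • H.domain.subtype))

/-- `f` lies in the domain of `H` near `a`: it coincides near `a` with an element of the
domain. -/
def InDomainNearLeft {a b : EReal} (H : L2 a b →ₗ.[ℂ] L2 a b) (f : ℝ → ℂ) : Prop :=
  ∃ g ∈ H.domain, ∃ c ∈ interval a b, ∀ᵐ x ∂(leb a b), x < c → f x = g x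

/-- `f` lies in the domain of `H` near `b`. -/
def InDomainNearRight {a b : EReal} (H : L2 a b →ₗ.[ℂ] L2 a b) (f : ℝ → ℂ) : Prop :=
  ∃ g ∈ H.domain, ∃ c ∈ interval a b, ∀ᵐ x ∂(leb a b), c < x → f x = g x

/-- The standing hypothesis on `H`, `φ`, `χ`: discrete spectrum with entire solutions in the
domain of `H` near `a` and near `b` (`χ` not identically zero), domination of `φ(w) χ(z)` on
compacts of `ℂ × ρ(H)`, and the limits of `W_x(φ(w), χ(z))` at the endpoints. Here
`W(z) = W(φ(z), χ(z))` may be evaluated at any point `y`. -/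
structure MainHypothesis (a b : EReal) (q : ℝ → ℝ) (H : L2 a b →ₗ.[ℂ] L2 a b)
    (φ χ : ℂ → ℝ → ℂ) : Prop where
  discrete : PurelyDiscrete H
  entire_left : IsEntireSolution a b q φ
  entire_right : IsEntireSolution a b q χ
  near_left : ∀ z, InDomainNearLeft H (φ z)
  near_right : ∀ z, InDomainNearRight H (χ z)
  nontrivial_right : ∃ z, ∃ x ∈ interval a b, χ z x ≠ 0
  dominated : ∀ K : Set (ℂ × ℂ), IsCompact K → K ⊆ Set.univ ×ˢ resolventSet H →
    ∃ F : ℝ → ℝ, Integrable F (leb a b) ∧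
      ∀ p ∈ K, ∀ x ∈ interval a b, ‖φ p.1 x * χ p.2 x‖ ≤ F x
  limit_left : ∀ w, ∀ z ∈ resolventSet H, ∀ y ∈ interval a b,
    Tendsto (wronskian (φ w) (χ z)) (toLeft a) (𝓝 (wronskian (φ z) (χ z) y))
  limit_right : ∀ w, ∀ z ∈ resolventSet H, ∀ y ∈ interval a b,
    Tendsto (wronskian (φ w) (χ z)) (toRight b) (𝓝 (wronskian (φ w) (χ w) y))

/-- `θ` completes `φ` to a fundamental system of entire solutions with `W(θ(z), φ(z)) = 1`. -/
structure IsFundamentalSystem (a b : EReal) (q : ℝ → ℝ) (φ θ : ℂ → ℝ → ℂ) : Prop where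
  entire : IsEntireSolution a b q θ
  wronskian_eq : ∀ z, ∀ x ∈ interval a b, wronskian (θ z) (φ z) x = 1

/-- The singular Weyl solution `ψ(z, x) = θ(z, x) + M(z) φ(z, x)`. -/
def weylSolution (φ θ : ℂ → ℝ → ℂ) (M : ℂ → ℂ) (z : ℂ) (x : ℝ) : ℂ := θ z x + M z * φ z x

/-- `M` is the singular Weyl function: it makes `ψ(z, ·)` lie in the domain of `H` near `b`
for every `z ∈ ρ(H)`. -/
def IsSingularWeylFunction {a b : EReal} (H : L2 a b →ₗ.[ℂ] L2 a b) (φ θ : ℂ → ℝ → ℂ)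
    (M : ℂ → ℂ) : Prop :=
  ∀ z ∈ resolventSet H, InDomainNearRight H (weylSolution φ θ M z)

/-- The derivative `ψ^{(j)}(z, x) = ∂ʲψ(z, x)/∂zʲ`. -/
def weylDeriv (φ θ : ℂ → ℝ → ℂ) (M : ℂ → ℂ) (j : ℕ) (z : ℂ) (x : ℝ) : ℂ :=
  iteratedDeriv j (fun ζ => weylSolution φ θ M ζ x) z

end SingularWeyl

end

/-!
Throughout, `W(z) = W_x(φ(z), χ(z))`.

At a point `z` of the resolvent set, no nonzero solution of `τ f = z f` lies in the domain of `H`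
near both endpoints (`eq_zero_of_mem_resolventSet`). Consequently `W(z) ≠ 0` there
(`wronskian_ne_zero`), and `ψ(z)` and `χ(z)`, both in the domain near `b`, are proportional:
`ψ(z) = -χ(z) / W(z)` (`weylSolution_eq`). Conversely `W` vanishes on the spectrum
(`wronskian_eq_zero_of_mem_spectrum`): by self-adjointness the boundary form of two functions in
the domain near an endpoint vanishes there (`tendsto_wronskian_right`, `tendsto_wronskian_left`),
so an eigenfunction is proportional to `φ(z)` and, unless `χ(z) = 0`, to `χ(z)`. So the resolvent
set is `{W ≠ 0}`; it is open and `ψ` is holomorphic on it.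

The derivative `ψ^{(j)}(z)` is a Cauchy integral of `-χ(ζ) / W(ζ)` over a small circle around `z`.
All that is claimed about it is transported through this integral: differentiability in `x`, by
the bounds for `χ(ζ, x)` and `χ'(ζ, x)` from Gronwall's inequality
(`exists_bound_entireSolution`); integrability of `φ(w) ψ^{(j)}(z)` and the limits at the
endpoints of `W_x(ψ^{(j)}(z), φ(w))`, by domination. At `a` the limit is `1` for `j = 0` and `0`
otherwise, at `b` it is a multiple `B j` of `W(w)`. As `τ ψ^{(j)} = z ψ^{(j)} + j ψ^{(j-1)}`, the
Lagrange identity yields for the integrals `I j` of `φ(w) ψ^{(j)}(z)` the recursion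
`(z - w) I j + j I (j - 1) = B j - δ_{j0}` (`integral_recursion`), which is solved by induction.
On the spectrum `W(w) = 0`, hence `B = 0`.
-/

/-! ### Absolutely continuous complex-valued functions -/

namespace AbsolutelyContinuousOnInterval

theorem lipschitzWith_comp {X Y : Type*} [PseudoMetricSpace X] [PseudoMetricSpace Y]
    {K : NNReal} {g : X → Y} (hg : LipschitzWith K g) {f : ℝ → X} {c d : ℝ}
    (hf : AbsolutelyContinuousOnInterval f c d) :
    AbsolutelyContinuousOnInterval (fun x => g (f x)) c d := by
  unfold AbsolutelyContinuousOnInterval at hf ⊢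
  refine squeeze_zero (fun E => Finset.sum_nonneg fun i _ => dist_nonneg) (fun E => ?_)
    (by simpa using hf.const_mul (K : ℝ))
  rw [Finset.mul_sum]
  exact Finset.sum_le_sum fun i _ => hg.dist_le_mul _ _

/-- The fundamental theorem of calculus, by splitting into real and imaginary parts. -/
theorem complex_intervalIntegrable_deriv_and_integral_deriv {f : ℝ → ℂ} {c d : ℝ}
    (hf : AbsolutelyContinuousOnInterval f c d) :
    IntervalIntegrable (deriv f) volume c d ∧ ∫ x in c..d, deriv f x = f d - f c := by
  have hu : AbsolutelyContinuousOnInterval (fun x => (f x).re) c d :=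
    hf.lipschitzWith_comp Complex.reCLM.lipschitz
  have hv : AbsolutelyContinuousOnInterval (fun x => (f x).im) c d :=
    hf.lipschitzWith_comp Complex.imCLM.lipschitz
  have hae : ∀ᵐ x, x ∈ Set.uIoc c d → deriv f x =
      ((deriv (fun x => (f x).re) x : ℝ) : ℂ) + ((deriv (fun x => (f x).im) x : ℝ) : ℂ) *
        Complex.I := by
    filter_upwards [hf.boundedVariationOn.ae_differentiableAt_of_mem_uIcc] with x hx hxm
    have h := (hx (Set.uIoc_subset_uIcc hxm)).hasDerivAt
    have h1 : HasDerivAt (fun x => (f x).re) (deriv f x).re x :=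
      Complex.reCLM.hasFDerivAt.comp_hasDerivAt x h
    have h2 : HasDerivAt (fun x => (f x).im) (deriv f x).im x :=
      Complex.imCLM.hasFDerivAt.comp_hasDerivAt x h
    rw [h1.deriv, h2.deriv, Complex.re_add_im]
  have hiu : IntervalIntegrable (fun x => ((deriv (fun x => (f x).re) x : ℝ) : ℂ)) volume c d :=
    ⟨hu.intervalIntegrable_deriv.1.ofReal, hu.intervalIntegrable_deriv.2.ofReal⟩
  have hiv : IntervalIntegrable
      (fun x => ((deriv (fun x => (f x).im) x : ℝ) : ℂ) * Complex.I) volume c d :=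
    IntervalIntegrable.mul_const
      ⟨hv.intervalIntegrable_deriv.1.ofReal, hv.intervalIntegrable_deriv.2.ofReal⟩ _
  constructor
  · refine (hiu.add hiv).congr_ae ?_
    rw [EventuallyEq, ae_restrict_iff' measurableSet_uIoc]
    filter_upwards [hae] with x hx hm using (hx hm).symm
  · rw [intervalIntegral.integral_congr_ae hae, intervalIntegral.integral_add hiu hiv,
      intervalIntegral.integral_mul_const, intervalIntegral.integral_ofReal,
      intervalIntegral.integral_ofReal, hu.integral_deriv_eq_sub, hv.integral_deriv_eq_sub]
    apply Complex.ext <;> simp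

end AbsolutelyContinuousOnInterval

namespace SingularWeyl

/-! ### The interval and its endpoint filters -/

theorem isOpen_interval (a b : EReal) : IsOpen (interval a b) :=
  (isOpen_lt continuous_const continuous_coe_real_ereal).inter
    (isOpen_lt continuous_coe_real_ereal continuous_const)

theorem measurableSet_interval (a b : EReal) : MeasurableSet (interval a b) :=
  (isOpen_interval a b).measurableSet

theorem uIcc_subset_interval {a b : EReal} {c d : ℝ} (hc : c ∈ interval a b)
    (hd : d ∈ interval a b) : Set.uIcc c d ⊆ interval a b := by
  intro x hx
  rcases Set.mem_uIcc.1 hx with h | h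
  · exact ⟨hc.1.trans_le (EReal.coe_le_coe_iff.2 h.1),
      (EReal.coe_le_coe_iff.2 h.2).trans_lt hd.2⟩
  · exact ⟨hd.1.trans_le (EReal.coe_le_coe_iff.2 h.1),
      (EReal.coe_le_coe_iff.2 h.2).trans_lt hc.2⟩

theorem nonempty_interval {a b : EReal} (hab : a < b) : (interval a b).Nonempty :=
  EReal.lt_iff_exists_real_btwn.1 hab

theorem eventually_toLeft {a b : EReal} {c : ℝ} (hc : c ∈ interval a b) :
    ∀ᶠ x in toLeft a, x ∈ interval a b ∧ x < c := by
  have : Set.Ioo a (c : EReal) ∈ 𝓝[>] a := Ioo_mem_nhdsGT hc.1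
  filter_upwards [preimage_mem_comap this] with x hx
  exact ⟨⟨hx.1, hx.2.trans hc.2⟩, EReal.coe_lt_coe_iff.1 hx.2⟩

theorem eventually_toRight {a b : EReal} {c : ℝ} (hc : c ∈ interval a b) :
    ∀ᶠ x in toRight b, x ∈ interval a b ∧ c < x := by
  have : Set.Ioo (c : EReal) b ∈ 𝓝[<] b := Ioo_mem_nhdsLT hc.2
  filter_upwards [preimage_mem_comap this] with x hx
  exact ⟨⟨hc.1.trans hx.1, hx.2⟩, EReal.coe_lt_coe_iff.1 hx.1⟩

theorem toLeft_neBot {a b : EReal} (hab : a < b) : (toLeft a).NeBot := by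
  refine comap_neBot_iff.2 fun t ht => ?_
  obtain ⟨u, hu, hut⟩ := (mem_nhdsGT_iff_exists_Ioo_subset' hab).1 ht
  obtain ⟨x, hx1, hx2⟩ := EReal.lt_iff_exists_real_btwn.1 hu
  exact ⟨x, hut ⟨hx1, hx2⟩⟩

theorem toRight_neBot {a b : EReal} (hab : a < b) : (toRight b).NeBot := by
  refine comap_neBot_iff.2 fun t ht => ?_
  obtain ⟨u, hu, hut⟩ := (mem_nhdsLT_iff_exists_Ioo_subset' hab).1 ht
  obtain ⟨x, hx1, hx2⟩ := EReal.lt_iff_exists_real_btwn.1 hu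
  exact ⟨x, hut ⟨hx1, hx2⟩⟩

instance isCountablyGenerated_toLeft (a : EReal) : (toLeft a).IsCountablyGenerated :=
  inferInstanceAs (comap Real.toEReal (𝓝[>] a)).IsCountablyGenerated

instance isCountablyGenerated_toRight (b : EReal) : (toRight b).IsCountablyGenerated :=
  inferInstanceAs (comap Real.toEReal (𝓝[<] b)).IsCountablyGenerated

theorem eventually_prod_interval {a b : EReal} (hab : a < b) :
    ∀ᶠ p : ℝ × ℝ in toLeft a ×ˢ toRight b,
      p.1 ∈ interval a b ∧ p.2 ∈ interval a b ∧ p.1 ≤ p.2 := by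
  obtain ⟨c, hc⟩ := nonempty_interval hab
  filter_upwards [(eventually_toLeft hc).prod_mk (eventually_toRight hc)] with p hp
  exact ⟨hp.1.1, hp.2.1, (hp.1.2.trans hp.2.2).le⟩

/-- An integral over `(a, b)` as the limit of integrals over `[c, d]`, where `c ↓ a`, `d ↑ b`. -/
theorem tendsto_intervalIntegral {a b : EReal} (hab : a < b) {k : ℝ → ℂ}
    (hk : Integrable k (leb a b)) :
    Tendsto (fun p : ℝ × ℝ => ∫ x in p.1..p.2, k x) (toLeft a ×ˢ toRight b)
      (𝓝 (∫ x in interval a b, k x)) := by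
  have hcov : AECover (leb a b) (toLeft a ×ˢ toRight b)
      (fun p : ℝ × ℝ => Set.Ioc p.1 p.2) := by
    refine ⟨?_, fun p => measurableSet_Ioc⟩
    rw [ae_restrict_iff' (measurableSet_interval a b)]
    refine ae_of_all _ fun x hx => ?_
    filter_upwards [(eventually_toLeft hx).prod_mk (eventually_toRight hx)] with p hp
    exact ⟨hp.1.2, hp.2.2.le⟩
  refine (hcov.integral_tendsto_of_countably_generated hk).congr' ?_
  filter_upwards [eventually_prod_interval hab] with p hp
  rw [intervalIntegral.integral_of_le hp.2.2, Measure.restrict_restrict measurableSet_Ioc,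
    Set.inter_eq_left.2]
  exact (Set.Ioc_subset_Icc_self.trans Set.Icc_subset_uIcc).trans
    (uIcc_subset_interval hp.1 hp.2.1)

theorem tendsto_of_tendsto_prod_toRight {a b : EReal} (hab : a < b) {V : ℝ → ℂ} {l : Filter ℂ}
    (h : Tendsto (fun p : ℝ × ℝ => V p.2) (toLeft a ×ˢ toRight b) l) :
    Tendsto V (toRight b) l := by
  have := toLeft_neBot hab
  rw [← map_snd_prod (toLeft a) (toRight b)]
  exact tendsto_map'_iff.2 h

theorem tendsto_of_tendsto_prod_toLeft {a b : EReal} (hab : a < b) {V : ℝ → ℂ} {l : Filter ℂ}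
    (h : Tendsto (fun p : ℝ × ℝ => V p.1) (toLeft a ×ˢ toRight b) l) :
    Tendsto V (toLeft a) l := by
  have := toRight_neBot hab
  rw [← map_fst_prod (toLeft a) (toRight b)]
  exact tendsto_map'_iff.2 h

/-! ### The Lagrange identity -/

theorem LocACDeriv.hasDerivAt {a b : EReal} {f : ℝ → ℂ} (hf : LocACDeriv a b f) {x : ℝ}
    (hx : x ∈ interval a b) : HasDerivAt f (deriv f x) x :=
  (hf.differentiableAt x hx).hasDerivAt

theorem LocACDeriv.continuousOn {a b : EReal} {f : ℝ → ℂ} (hf : LocACDeriv a b f) :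
    ContinuousOn f (interval a b) :=
  fun x hx => (hf.differentiableAt x hx).continuousAt.continuousWithinAt

theorem LocACDeriv.continuousOn_deriv {a b : EReal} {f : ℝ → ℂ} (hf : LocACDeriv a b f) :
    ContinuousOn (deriv f) (interval a b) := by
  intro x hx
  obtain ⟨c, d, hx', hn, hcd⟩ :=
    exists_Icc_mem_subset_of_mem_nhds ((isOpen_interval a b).mem_nhds hx)
  have hle : c ≤ d := hx'.1.trans hx'.2
  have h := (hf.ac_deriv c (hcd ⟨le_rfl, hle⟩) d (hcd ⟨hle, le_rfl⟩)).continuousOn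
  rw [Set.uIcc_of_le hle] at h
  exact (h.continuousAt hn).continuousWithinAt

theorem LocACDeriv.ac {a b : EReal} {f : ℝ → ℂ} (hf : LocACDeriv a b f) {c d : ℝ}
    (hc : c ∈ interval a b) (hd : d ∈ interval a b) : AbsolutelyContinuousOnInterval f c d := by
  obtain ⟨C, hC⟩ := (hf.ac_deriv c hc d hd).exists_bound
  have : LipschitzOnWith C.toNNReal f (Set.uIcc c d) :=
    (convex_uIcc c d).lipschitzOnWith_of_nnnorm_deriv_le
      (fun x hx => hf.differentiableAt x (uIcc_subset_interval hc hd hx))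
      (fun x hx => by
        rw [← NNReal.coe_le_coe, coe_nnnorm]
        exact (hC x hx).trans (Real.le_coe_toNNReal C))
  exact this.absolutelyContinuousOnInterval

theorem LocACDeriv.ae_differentiableAt_deriv {a b : EReal} {f : ℝ → ℂ} (hf : LocACDeriv a b f) :
    ∀ᵐ x ∂(leb a b), DifferentiableAt ℝ (deriv f) x := by
  -- The interval is covered by countably many compact ones, those with rational endpoints.
  have key : ∀ p : ℚ × ℚ, ∀ᵐ x : ℝ, (p.1 : ℝ) ∈ interval a b → (p.2 : ℝ) ∈ interval a b →
      x ∈ Set.uIcc (p.1 : ℝ) p.2 → DifferentiableAt ℝ (deriv f) x := by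
    intro p
    by_cases h1 : (p.1 : ℝ) ∈ interval a b
    · by_cases h2 : (p.2 : ℝ) ∈ interval a b
      · filter_upwards [(hf.ac_deriv _ h1 _ h2).boundedVariationOn.ae_differentiableAt_of_mem_uIcc]
          with x hx _ _ using hx
      · exact ae_of_all _ fun x _ h => absurd h h2
    · exact ae_of_all _ fun x h => absurd h h1
  rw [ae_restrict_iff' (measurableSet_interval a b)]
  filter_upwards [ae_all_iff.2 key] with x hx hxm
  obtain ⟨c, hc1, hc2⟩ := EReal.exists_rat_btwn_of_lt hxm.1
  obtain ⟨d, hd1, hd2⟩ := EReal.exists_rat_btwn_of_lt hxm.2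
  have hc2' : (c : ℝ) < x := EReal.coe_lt_coe_iff.1 hc2
  have hd1' : x < (d : ℝ) := EReal.coe_lt_coe_iff.1 hd1
  exact hx (c, d) ⟨hc1, hc2.trans hxm.2⟩ ⟨hxm.1.trans hd1, hd2⟩
    (Set.mem_uIcc.2 (Or.inl ⟨hc2'.le, hd1'.le⟩))

theorem ae_of_ae_leb {a b : EReal} {p : ℝ → Prop} (h : ∀ᵐ x ∂(leb a b), p x) {c d : ℝ}
    (hc : c ∈ interval a b) (hd : d ∈ interval a b) : ∀ᵐ x, x ∈ Set.uIoc c d → p x := by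
  rw [ae_restrict_iff' (measurableSet_interval a b)] at h
  filter_upwards [h] with x hx hm
  exact hx (uIcc_subset_interval hc hd (Set.uIoc_subset_uIcc hm))

/-- The Lagrange identity; the potential cancels, so that no integrability of `q` is needed. -/
theorem lagrange {a b : EReal} (q : ℝ → ℝ) {f g : ℝ → ℂ} (hf : LocACDeriv a b f)
    (hg : LocACDeriv a b g) {c d : ℝ} (hc : c ∈ interval a b) (hd : d ∈ interval a b) :
    ∫ x in c..d, (tau q f x * g x - f x * tau q g x) = wronskian f g d - wronskian f g c := by
  have hW : AbsolutelyContinuousOnInterval (wronskian f g) c d :=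
    ((hf.ac hc hd).smul (hg.ac_deriv c hc d hd)).sub ((hf.ac_deriv c hc d hd).smul (hg.ac hc hd))
  rw [← hW.complex_intervalIntegrable_deriv_and_integral_deriv.2]
  refine intervalIntegral.integral_congr_ae ?_
  filter_upwards [ae_of_ae_leb hf.ae_differentiableAt_deriv hc hd,
    ae_of_ae_leb hg.ae_differentiableAt_deriv hc hd] with x h1 h2 hm
  have hx := uIcc_subset_interval hc hd (Set.uIoc_subset_uIcc hm)
  have h : HasDerivAt (wronskian f g) _ x := ((hf.hasDerivAt hx).mul (h2 hm).hasDerivAt).sub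
    ((h1 hm).hasDerivAt.mul (hg.hasDerivAt hx))
  rw [h.deriv]
  simp only [tau]
  ring

theorem wronskian_sub_wronskian {a b : EReal} {q : ℝ → ℝ} {w z : ℂ} {f g : ℝ → ℂ}
    (hf : IsSolution a b q w f) (hg : IsSolution a b q z g) {c d : ℝ} (hc : c ∈ interval a b)
    (hd : d ∈ interval a b) :
    wronskian f g d - wronskian f g c = ∫ x in c..d, (w - z) * (f x * g x) := by
  rw [← lagrange q hf.locAC hg.locAC hc hd]
  refine intervalIntegral.integral_congr_ae ?_
  filter_upwards [ae_of_ae_leb hf.eqn hc hd, ae_of_ae_leb hg.eqn hc hd] with x h1 h2 hm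
  rw [h1 hm, h2 hm]
  ring

/-- The Wronskian of two solutions is continuously differentiable. -/
theorem hasDerivAt_wronskian {a b : EReal} {q : ℝ → ℝ} {w z : ℂ} {f g : ℝ → ℂ}
    (hf : IsSolution a b q w f) (hg : IsSolution a b q z g) {x : ℝ} (hx : x ∈ interval a b) :
    HasDerivAt (wronskian f g) ((w - z) * (f x * g x)) x := by
  have hcont : ContinuousOn (fun x => (w - z) * (f x * g x)) (interval a b) :=
    continuousOn_const.mul (hf.locAC.continuousOn.mul hg.locAC.continuousOn)
  have hnhds := (isOpen_interval a b).mem_nhds hx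
  have h := intervalIntegral.integral_hasDerivAt_right (a := x) (b := x)
    (f := fun x => (w - z) * (f x * g x)) (by simp)
    (hcont.stronglyMeasurableAtFilter (isOpen_interval a b) x hx)
    (hcont.continuousAt hnhds)
  refine (h.const_add (wronskian f g x)).congr_of_eventuallyEq ?_
  filter_upwards [hnhds] with y hy
  rw [← wronskian_sub_wronskian hf hg hx hy]
  ring

theorem wronskian_eq_wronskian {a b : EReal} {q : ℝ → ℝ} {z : ℂ} {f g : ℝ → ℂ}
    (hf : IsSolution a b q z f) (hg : IsSolution a b q z g) {c d : ℝ} (hc : c ∈ interval a b)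
    (hd : d ∈ interval a b) : wronskian f g d = wronskian f g c := by
  have := wronskian_sub_wronskian hf hg hc hd
  simpa [sub_eq_zero] using this

theorem eventually_wronskian_eq {l : Filter ℝ} {f f' g g' : ℝ → ℂ} {s : Set ℝ} (hs : IsOpen s)
    (hl : ∀ᶠ x in l, x ∈ s) (hf : Set.EqOn f f' s) (hg : Set.EqOn g g' s) :
    wronskian f g =ᶠ[l] wronskian f' g' := by
  filter_upwards [hl] with x hx
  simp only [wronskian, hf hx, hg hx, (hf.eventuallyEq_of_mem (hs.mem_nhds hx)).deriv_eq,
    (hg.eventuallyEq_of_mem (hs.mem_nhds hx)).deriv_eq]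

theorem wronskian_swap (f g : ℝ → ℂ) (x : ℝ) : wronskian g f x = -wronskian f g x := by
  simp only [wronskian]; ring

end SingularWeyl

namespace SingularWeyl

/-! ### Functions in the domain near an endpoint -/

/-- `v` and `u` describe the domain of `H`: it consists of the functions `g` of the maximal domain
with `W_a(v, g) = 0` and `W_b(u, g) = 0`. -/
structure IsBoundaryPair (a b : EReal) (q : ℝ → ℝ) (H : L2 a b →ₗ.[ℂ] L2 a b)
    (v u : ℝ → ℂ) : Prop where
  left : MaxDomain a b q v
  right : MaxDomain a b q u
  mem_domain_iff : ∀ f : L2 a b, f ∈ H.domain ↔ ∃ g : ℝ → ℂ, MaxDomain a b q g ∧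
    f =ᵐ[leb a b] g ∧ Tendsto (wronskian v g) (toLeft a) (𝓝 0) ∧
    Tendsto (wronskian u g) (toRight b) (𝓝 0)

theorem IsSeparatedRealization.exists_isBoundaryPair {a b : EReal} {q : ℝ → ℝ}
    {H : L2 a b →ₗ.[ℂ] L2 a b} (hH : IsSeparatedRealization a b q H) :
    ∃ v u, IsBoundaryPair a b q H v u := by
  obtain ⟨v, u, hv, hu, -, -, h⟩ := hH.domain
  exact ⟨v, u, hv, hu, h⟩

theorem InDomainNearRight.add {a b : EReal} {H : L2 a b →ₗ.[ℂ] L2 a b} {f g : ℝ → ℂ}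
    (hf : InDomainNearRight H f) (hg : InDomainNearRight H g) :
    InDomainNearRight H (fun x => f x + g x) := by
  obtain ⟨F, hF, c, hc, hcF⟩ := hf
  obtain ⟨G, hG, d, hd, hdG⟩ := hg
  refine ⟨F + G, H.domain.add_mem hF hG, max c d, ?_, ?_⟩
  · rcases max_choice c d with h | h <;> rwa [h]
  · filter_upwards [hcF, hdG, Lp.coeFn_add F G] with x h1 h2 h3 hx
    rw [h3, Pi.add_apply, h1 ((le_max_left _ _).trans_lt hx), h2 ((le_max_right _ _).trans_lt hx)]

theorem InDomainNearRight.const_mul {a b : EReal} {H : L2 a b →ₗ.[ℂ] L2 a b} {f : ℝ → ℂ}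
    (r : ℂ) (hf : InDomainNearRight H f) : InDomainNearRight H (fun x => r * f x) := by
  obtain ⟨F, hF, c, hc, hcF⟩ := hf
  refine ⟨r • F, H.domain.smul_mem r hF, c, hc, ?_⟩
  filter_upwards [hcF, Lp.coeFn_smul r F] with x h1 h2 hx
  rw [h2, Pi.smul_apply, h1 hx, smul_eq_mul]

theorem InDomainNearRight.congr {a b : EReal} {H : L2 a b →ₗ.[ℂ] L2 a b} {f g : ℝ → ℂ}
    (hf : InDomainNearRight H f) (h : ∀ x ∈ interval a b, g x = f x) :
    InDomainNearRight H g := by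
  obtain ⟨F, hF, c, hc, hcF⟩ := hf
  refine ⟨F, hF, c, hc, ?_⟩
  filter_upwards [hcF, ae_restrict_mem (measurableSet_interval a b)] with x h1 h2 hx
  rw [h x h2, h1 hx]

theorem IsBoundaryPair.exists_eqOn_right {a b : EReal} {q : ℝ → ℝ} {H : L2 a b →ₗ.[ℂ] L2 a b}
    {v u : ℝ → ℂ} (hp : IsBoundaryPair a b q H v u) {f : ℝ → ℂ} (hf : LocACDeriv a b f)
    (hn : InDomainNearRight H f) :
    ∃ g c, c ∈ interval a b ∧ MaxDomain a b q g ∧ Set.EqOn f g (interval a b ∩ Set.Ioi c) ∧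
      Tendsto (wronskian u g) (toRight b) (𝓝 0) := by
  obtain ⟨F, hF, c, hc, hcF⟩ := hn
  obtain ⟨g, hg, hFg, -, hug⟩ := (hp.mem_domain_iff F).1 hF
  refine ⟨g, c, hc, hg, ?_, hug⟩
  refine Measure.eqOn_open_of_ae_eq (μ := volume) ?_ ((isOpen_interval a b).inter isOpen_Ioi)
    (hf.continuousOn.mono Set.inter_subset_left) (hg.locAC.continuousOn.mono Set.inter_subset_left)
  rw [Set.inter_comm, ← Measure.restrict_restrict measurableSet_Ioi, EventuallyEq,
    ae_restrict_iff' measurableSet_Ioi]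
  filter_upwards [hcF, hFg] with x h1 h2 hx
  rw [h1 hx, h2]

theorem IsBoundaryPair.exists_eqOn_left {a b : EReal} {q : ℝ → ℝ} {H : L2 a b →ₗ.[ℂ] L2 a b}
    {v u : ℝ → ℂ} (hp : IsBoundaryPair a b q H v u) {f : ℝ → ℂ} (hf : LocACDeriv a b f)
    (hn : InDomainNearLeft H f) :
    ∃ g c, c ∈ interval a b ∧ MaxDomain a b q g ∧ Set.EqOn f g (interval a b ∩ Set.Iio c) ∧
      Tendsto (wronskian v g) (toLeft a) (𝓝 0) := by
  obtain ⟨F, hF, c, hc, hcF⟩ := hn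
  obtain ⟨g, hg, hFg, hvg, -⟩ := (hp.mem_domain_iff F).1 hF
  refine ⟨g, c, hc, hg, ?_, hvg⟩
  refine Measure.eqOn_open_of_ae_eq (μ := volume) ?_ ((isOpen_interval a b).inter isOpen_Iio)
    (hf.continuousOn.mono Set.inter_subset_left) (hg.locAC.continuousOn.mono Set.inter_subset_left)
  rw [Set.inter_comm, ← Measure.restrict_restrict measurableSet_Iio, EventuallyEq,
    ae_restrict_iff' measurableSet_Iio]
  filter_upwards [hcF, hFg] with x h1 h2 hx
  rw [h1 hx, h2]

/-- Replacing `g` by a function that agrees with it near `b` does not change `W_b(u, g)`. -/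
theorem tendsto_wronskian_right_congr {a b : EReal} {u f g : ℝ → ℂ} {c : ℝ} {l : Filter ℂ}
    (hc : c ∈ interval a b) (hfg : Set.EqOn f g (interval a b ∩ Set.Ioi c))
    (h : Tendsto (wronskian u g) (toRight b) l) : Tendsto (wronskian u f) (toRight b) l :=
  h.congr' (eventually_wronskian_eq ((isOpen_interval a b).inter isOpen_Ioi)
    (eventually_toRight hc) (Set.eqOn_refl _ _) hfg.symm)

theorem tendsto_wronskian_left_congr {a b : EReal} {v f g : ℝ → ℂ} {c : ℝ} {l : Filter ℂ}
    (hc : c ∈ interval a b) (hfg : Set.EqOn f g (interval a b ∩ Set.Iio c))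
    (h : Tendsto (wronskian v g) (toLeft a) l) : Tendsto (wronskian v f) (toLeft a) l :=
  h.congr' (eventually_wronskian_eq ((isOpen_interval a b).inter isOpen_Iio)
    (eventually_toLeft hc) (Set.eqOn_refl _ _) hfg.symm)

/-- A continuous function that is square integrable near both endpoints is square integrable. -/
theorem memLp_of_eqOn {a b : EReal} {f g h : ℝ → ℂ} {c d : ℝ} (hc : c ∈ interval a b)
    (hd : d ∈ interval a b) (hf : ContinuousOn f (interval a b)) (hg : MemLp g 2 (leb a b))
    (hh : MemLp h 2 (leb a b)) (hfg : Set.EqOn f g (interval a b ∩ Set.Iio c))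
    (hfh : Set.EqOn f h (interval a b ∩ Set.Ioi d)) : MemLp f 2 (leb a b) := by
  rw [memLp_two_iff_integrable_sq_norm
    (hf.aestronglyMeasurable (measurableSet_interval a b))]
  have hg2 : IntegrableOn (fun x => ‖g x‖ ^ 2) (interval a b) :=
    (memLp_two_iff_integrable_sq_norm hg.1).1 hg
  have hh2 : IntegrableOn (fun x => ‖h x‖ ^ 2) (interval a b) :=
    (memLp_two_iff_integrable_sq_norm hh.1).1 hh
  have h1 : IntegrableOn (fun x => ‖f x‖ ^ 2) (interval a b ∩ Set.Iio c) :=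
    (hg2.mono_set Set.inter_subset_left).congr_fun (fun x hx => by simp only [hfg hx])
      ((measurableSet_interval a b).inter measurableSet_Iio)
  have h2 : IntegrableOn (fun x => ‖f x‖ ^ 2) (interval a b ∩ Set.Ioi d) :=
    (hh2.mono_set Set.inter_subset_left).congr_fun (fun x hx => by simp only [hfh hx])
      ((measurableSet_interval a b).inter measurableSet_Ioi)
  have h3 : IntegrableOn (fun x => ‖f x‖ ^ 2) (Set.uIcc c d) :=
    ((hf.mono (uIcc_subset_interval hc hd)).norm.pow 2).integrableOn_compact isCompact_uIcc
  refine IntegrableOn.mono_set ((h1.union h3).union h2) fun x hx => ?_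
  rcases lt_or_ge x c with h | h
  · exact Or.inl (Or.inl ⟨hx, h⟩)
  rcases lt_or_ge d x with h' | h'
  · exact Or.inr ⟨hx, h'⟩
  · exact Or.inl (Or.inr (Set.mem_uIcc.2 (Or.inl ⟨h, h'⟩)))

/-- At a point of the resolvent set only the zero solution satisfies both boundary conditions. -/
theorem eq_zero_of_mem_resolventSet {a b : EReal} {q : ℝ → ℝ} {H : L2 a b →ₗ.[ℂ] L2 a b}
    (hH : IsSeparatedRealization a b q H) {z : ℂ} (hz : z ∈ resolventSet H) {f : ℝ → ℂ}
    (hf : IsSolution a b q z f) (hl : InDomainNearLeft H f) (hr : InDomainNearRight H f) :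
    Set.EqOn f 0 (interval a b) := by
  obtain ⟨v, u, hp⟩ := hH.exists_isBoundaryPair
  obtain ⟨g, c, hc, hg, hfg, hvg⟩ := hp.exists_eqOn_left hf.locAC hl
  obtain ⟨h, d, hd, hh, hfh, huh⟩ := hp.exists_eqOn_right hf.locAC hr
  have hmem : MemLp f 2 (leb a b) :=
    memLp_of_eqOn hc hd hf.locAC.continuousOn hg.memLp hh.memLp hfg hfh
  have hmax : MaxDomain a b q f :=
    ⟨hf.locAC, hmem, (hmem.const_mul z).ae_eq (hf.eqn.mono fun x hx => hx.symm)⟩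
  have hdom : hmem.toLp f ∈ H.domain := (hp.mem_domain_iff _).2
    ⟨f, hmax, hmem.coeFn_toLp, tendsto_wronskian_left_congr hc hfg hvg,
      tendsto_wronskian_right_congr hd hfh huh⟩
  obtain ⟨R, -, hR⟩ := hz
  have hHf : H ⟨_, hdom⟩ - z • hmem.toLp f = 0 := by
    rw [sub_eq_zero]
    apply Lp.ext
    filter_upwards [hH.apply ⟨_, hdom⟩ f hmax hmem.coeFn_toLp, hf.eqn,
      Lp.coeFn_smul z (hmem.toLp f), hmem.coeFn_toLp] with x h1 h2 h3 h4
    rw [h1, h2, h3, Pi.smul_apply, h4, smul_eq_mul]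
  have hzero : hmem.toLp f = 0 := by
    have := hR ⟨_, hdom⟩
    rw [hHf, map_zero] at this
    exact this.symm
  refine Measure.eqOn_open_of_ae_eq (μ := volume) ?_ (isOpen_interval a b)
    hf.locAC.continuousOn continuousOn_const
  have h0 := Lp.coeFn_zero ℂ 2 (leb a b)
  rw [← hzero] at h0
  exact hmem.coeFn_toLp.symm.trans h0

/-- A point of the spectrum has an eigenfunction. -/
theorem exists_eigenfunction {a b : EReal} {q : ℝ → ℝ} {H : L2 a b →ₗ.[ℂ] L2 a b}
    (hH : IsSeparatedRealization a b q H) (hd : PurelyDiscrete H) {v u : ℝ → ℂ}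
    (hp : IsBoundaryPair a b q H v u) {z : ℂ} (hz : z ∈ spectrum H) :
    ∃ g, IsSolution a b q z g ∧ (∃ x ∈ interval a b, g x ≠ 0) ∧ MaxDomain a b q g ∧
      Tendsto (wronskian v g) (toLeft a) (𝓝 0) ∧ Tendsto (wronskian u g) (toRight b) (𝓝 0) := by
  obtain ⟨F, hF, hF0⟩ := (Submodule.ne_bot_iff _).1 (hd z hz).2.1
  obtain ⟨g, hg, hFg, hvg, hug⟩ := (hp.mem_domain_iff F).1 F.2
  have hHF : H F = z • (F : L2 a b) := by
    simpa [sub_eq_zero] using hF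
  refine ⟨g, ⟨hg.locAC, ?_⟩, ?_, hg, hvg, hug⟩
  · filter_upwards [hH.apply F g hg hFg, Lp.coeFn_smul z (F : L2 a b), hFg] with x h1 h2 h3
    rw [← h1, hHF, h2, Pi.smul_apply, h3, smul_eq_mul]
  · by_contra! h
    refine hF0 (Subtype.ext (Lp.ext ?_))
    filter_upwards [hFg, ae_restrict_mem (measurableSet_interval a b),
      Lp.coeFn_zero ℂ 2 (leb a b)] with x h1 h2 h3
    rw [h1, h x h2]
    exact h3.symm

end SingularWeyl

theorem AbsolutelyContinuousOnInterval.congr_of_eqOn {X : Type*} [PseudoMetricSpace X]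
    {f g : ℝ → X} {c d : ℝ} (hf : AbsolutelyContinuousOnInterval f c d)
    (h : Set.EqOn f g (Set.uIcc c d)) : AbsolutelyContinuousOnInterval g c d := by
  unfold AbsolutelyContinuousOnInterval at hf ⊢
  refine hf.congr' ?_
  filter_upwards [mem_inf_of_right (mem_principal_self _)] with E hE
  refine Finset.sum_congr rfl fun i hi => ?_
  rw [h (hE.1 i hi).1, h (hE.1 i hi).2]

namespace SingularWeyl

/-! ### Boundary forms of functions in the domain of `H` -/

theorem deriv_star_comp (f : ℝ → ℂ) :
    deriv (fun x => star (f x)) = fun x => star (deriv f x) :=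
  funext fun _ => deriv.star

theorem tau_star (q : ℝ → ℝ) (f : ℝ → ℂ) :
    tau q (fun x => star (f x)) = fun x => star (tau q f x) := by
  funext x
  simp only [tau, deriv_star_comp]
  simp

theorem wronskian_star (f g : ℝ → ℂ) :
    wronskian (fun x => star (f x)) (fun x => star (g x)) = fun x => star (wronskian f g x) := by
  funext x
  simp only [wronskian, deriv_star_comp]
  simp

theorem memLp_star {μ : Measure ℝ} {f : ℝ → ℂ} (hf : MemLp f 2 μ) :
    MemLp (fun x => star (f x)) 2 μ :=
  ⟨continuous_star.comp_aestronglyMeasurable hf.1, by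
    rw [eLpNorm_congr_norm_ae (g := f) (ae_of_all _ fun x => norm_star _)]; exact hf.2⟩

/-- The potential is real, so the maximal domain is invariant under complex conjugation. -/
theorem MaxDomain.star {a b : EReal} {q : ℝ → ℝ} {f : ℝ → ℂ} (hf : MaxDomain a b q f) :
    MaxDomain a b q (fun x => star (f x)) := by
  refine ⟨⟨fun x hx => (hf.locAC.differentiableAt x hx).star, fun c hc d hd => ?_⟩,
    memLp_star hf.memLp, ?_⟩
  · rw [deriv_star_comp]
    exact (hf.locAC.ac_deriv c hc d hd).lipschitzWith_comp (LipschitzWith.of_dist_le_mul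
      (K := 1) fun x y => by
        rw [dist_eq_norm, dist_eq_norm, ← star_sub, norm_star, NNReal.coe_one, one_mul])
  · rw [tau_star]
    exact memLp_star hf.memLp_tau

/-- The maximal domain is invariant under multiplication with a bounded smooth function that is
constant near both endpoints. -/
theorem MaxDomain.cutoff_mul {a b : EReal} {q : ℝ → ℝ} {f : ℝ → ℂ} (hf : MaxDomain a b q f)
    {η : ℝ → ℂ} (hη : ContDiff ℝ 2 η) (hbd : ∀ x, ‖η x‖ ≤ 1) {c d : ℝ} (hc : c ∈ interval a b)
    (hd : d ∈ interval a b) {e e' : ℂ} (hl : Set.EqOn η (fun _ => e) (Set.Iio c))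
    (hr : Set.EqOn η (fun _ => e') (Set.Ioi d)) : MaxDomain a b q (fun x => η x * f x) := by
  have hη1 : ContDiff ℝ 1 (deriv η) := ((contDiff_succ_iff_deriv (n := 1)).1 hη).2.2
  have hη2 : Continuous (deriv (deriv η)) := hη1.continuous_deriv le_rfl
  have hdη : ∀ x, HasDerivAt η (deriv η x) x := fun x =>
    (hη.differentiable (by norm_num) x).hasDerivAt
  have hdη1 : ∀ x, HasDerivAt (deriv η) (deriv (deriv η) x) x := fun x =>
    (hη1.differentiable (by norm_num) x).hasDerivAt
  have hl1 : Set.EqOn (deriv η) (fun _ => 0) (Set.Iio c) := fun x hx => by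
    rw [(hl.eventuallyEq_of_mem (isOpen_Iio.mem_nhds hx)).deriv_eq, deriv_const]
  have hr1 : Set.EqOn (deriv η) (fun _ => 0) (Set.Ioi d) := fun x hx => by
    rw [(hr.eventuallyEq_of_mem (isOpen_Ioi.mem_nhds hx)).deriv_eq, deriv_const]
  have hl2 : Set.EqOn (deriv (deriv η)) (fun _ => 0) (Set.Iio c) := fun x hx => by
    rw [(hl1.eventuallyEq_of_mem (isOpen_Iio.mem_nhds hx)).deriv_eq, deriv_const]
  have hr2 : Set.EqOn (deriv (deriv η)) (fun _ => 0) (Set.Ioi d) := fun x hx => by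
    rw [(hr1.eventuallyEq_of_mem (isOpen_Ioi.mem_nhds hx)).deriv_eq, deriv_const]
  have hder : ∀ x ∈ interval a b,
      HasDerivAt (fun x => η x * f x) (deriv η x * f x + η x * deriv f x) x :=
    fun x hx => (hdη x).mul (hf.locAC.hasDerivAt hx)
  have hder' : Set.EqOn (deriv fun x => η x * f x)
      (fun x => deriv η x * f x + η x * deriv f x) (interval a b) :=
    fun x hx => (hder x hx).deriv
  refine ⟨⟨fun x hx => (hder x hx).differentiableAt, fun s hs t ht => ?_⟩, ?_, ?_⟩
  · have h1 : AbsolutelyContinuousOnInterval (deriv η) s t :=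
      hη1.contDiffOn.absolutelyContinuousOnInterval
    have h0 : AbsolutelyContinuousOnInterval η s t :=
      (hη.of_le (by norm_num)).contDiffOn.absolutelyContinuousOnInterval
    exact ((h1.smul (hf.locAC.ac hs ht)).add (h0.smul (hf.locAC.ac_deriv s hs t ht))).congr_of_eqOn
      fun x hx => (hder' (uIcc_subset_interval hs ht hx)).symm
  · refine hf.memLp.of_le (hη.continuous.aestronglyMeasurable.mul hf.memLp.1)
      (ae_of_all _ fun x => ?_)
    rw [norm_mul]
    exact mul_le_of_le_one_left (norm_nonneg _) (hbd x)
  · have hA : MemLp (fun x => η x * tau q f x) 2 (leb a b) := by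
      refine hf.memLp_tau.of_le (hη.continuous.aestronglyMeasurable.mul hf.memLp_tau.1)
        (ae_of_all _ fun x => ?_)
      rw [norm_mul]
      exact mul_le_of_le_one_left (norm_nonneg _) (hbd x)
    have hB : MemLp (fun x => deriv (deriv η) x * f x + 2 * (deriv η x * deriv f x)) 2
        (leb a b) := by
      refine memLp_of_eqOn (g := 0) (h := 0) hc hd ?_ MemLp.zero MemLp.zero
        (fun x hx => ?_) (fun x hx => ?_)
      · exact (hη2.continuousOn.mul hf.locAC.continuousOn).add
          (continuousOn_const.mul (hη1.continuous.continuousOn.mul hf.locAC.continuousOn_deriv))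
      · simp [hl1 hx.2, hl2 hx.2]
      · simp [hr1 hx.2, hr2 hx.2]
    refine (hA.sub hB).ae_eq ?_
    filter_upwards [hf.locAC.ae_differentiableAt_deriv,
      ae_restrict_mem (measurableSet_interval a b)] with x hx hxm
    have h2 : HasDerivAt (fun x => deriv η x * f x + η x * deriv f x) _ x :=
      ((hdη1 x).mul (hf.locAC.hasDerivAt hxm)).add ((hdη x).mul hx.hasDerivAt)
    have h3 := h2.congr_of_eventuallyEq
      (hder'.eventuallyEq_of_mem ((isOpen_interval a b).mem_nhds hxm))
    simp only [tau, Pi.sub_apply]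
    rw [h3.deriv]
    ring

/-- Self-adjointness of `H`, in terms of the boundary forms at both endpoints. -/
theorem tendsto_wronskian_star_sub {a b : EReal} (hab : a < b) {q : ℝ → ℝ}
    {H : L2 a b →ₗ.[ℂ] L2 a b} (hH : IsSeparatedRealization a b q H) {v u : ℝ → ℂ}
    (hp : IsBoundaryPair a b q H v u) {f g : ℝ → ℂ} (hf : MaxDomain a b q f)
    (hg : MaxDomain a b q g) (hvf : Tendsto (wronskian v f) (toLeft a) (𝓝 0))
    (huf : Tendsto (wronskian u f) (toRight b) (𝓝 0))
    (hvg : Tendsto (wronskian v g) (toLeft a) (𝓝 0))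
    (hug : Tendsto (wronskian u g) (toRight b) (𝓝 0)) :
    Tendsto (fun p : ℝ × ℝ => wronskian (fun x => star (f x)) g p.2 -
      wronskian (fun x => star (f x)) g p.1) (toLeft a ×ˢ toRight b) (𝓝 0) := by
  have hF : hf.memLp.toLp f ∈ H.domain :=
    (hp.mem_domain_iff _).2 ⟨f, hf, hf.memLp.coeFn_toLp, hvf, huf⟩
  have hG : hg.memLp.toLp g ∈ H.domain :=
    (hp.mem_domain_iff _).2 ⟨g, hg, hg.memLp.coeFn_toLp, hvg, hug⟩
  have hform : H.IsFormalAdjoint H := by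
    have h := LinearPMap.adjoint_isFormalAdjoint hH.selfAdjoint.dense_domain
    rwa [LinearPMap.isSelfAdjoint_def.1 hH.selfAdjoint] at h
  have hsymm := hform ⟨_, hF⟩ ⟨_, hG⟩
  rw [L2.inner_def, L2.inner_def] at hsymm
  have hHF := hH.apply ⟨_, hF⟩ f hf hf.memLp.coeFn_toLp
  have hHG := hH.apply ⟨_, hG⟩ g hg hg.memLp.coeFn_toLp
  have hi1 : Integrable (fun x => tau q (fun x => star (f x)) x * g x) (leb a b) :=
    hf.star.memLp_tau.integrable_mul hg.memLp
  have hi2 : Integrable (fun x => star (f x) * tau q g x) (leb a b) :=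
    hf.star.memLp.integrable_mul hg.memLp_tau
  have h0 : ∫ x in interval a b,
      (tau q (fun x => star (f x)) x * g x - star (f x) * tau q g x) = 0 := by
    rw [integral_sub hi1 hi2, sub_eq_zero]
    convert hsymm using 1
    · refine integral_congr_ae ?_
      filter_upwards [hHF, hg.memLp.coeFn_toLp] with x h1 h2
      rw [h1, h2, tau_star]
      simp [RCLike.inner_apply, mul_comm]
    · refine integral_congr_ae ?_
      filter_upwards [hHG, hf.memLp.coeFn_toLp] with x h1 h2
      rw [h1, h2]
      simp [RCLike.inner_apply, mul_comm]
  have h := tendsto_intervalIntegral hab (hi1.sub hi2)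
  simp only [Pi.sub_apply] at h
  rw [h0] at h
  refine h.congr' ?_
  filter_upwards [eventually_prod_interval hab] with p hp
  exact lagrange q hf.star.locAC hg.locAC hp.1 hp.2.1

/-- The smooth step from `0` on `(-∞, c]` to `1` on `[d, ∞)`. -/
noncomputable def smoothStep (c d x : ℝ) : ℂ := (Real.smoothTransition ((x - c) / (d - c)) : ℝ)

theorem contDiff_smoothStep (c d : ℝ) : ContDiff ℝ 2 (smoothStep c d) :=
  Complex.ofRealCLM.contDiff.comp
    (Real.smoothTransition.contDiff.comp ((contDiff_id.sub contDiff_const).div_const _))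

theorem smoothStep_of_le {c d x : ℝ} (hcd : c < d) (hx : x ≤ c) : smoothStep c d x = 0 := by
  rw [smoothStep, Real.smoothTransition.zero_of_nonpos, Complex.ofReal_zero]
  exact div_nonpos_of_nonpos_of_nonneg (by linarith) (by linarith)

theorem smoothStep_of_ge {c d x : ℝ} (hcd : c < d) (hx : d ≤ x) : smoothStep c d x = 1 := by
  rw [smoothStep, Real.smoothTransition.one_of_one_le, Complex.ofReal_one]
  rw [le_div_iff₀ (by linarith)]
  linarith

theorem norm_smoothStep_le (c d x : ℝ) : ‖smoothStep c d x‖ ≤ 1 := by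
  rw [smoothStep, Complex.norm_real, Real.norm_of_nonneg (Real.smoothTransition.nonneg _)]
  exact Real.smoothTransition.le_one _

theorem norm_one_sub_smoothStep_le (c d x : ℝ) : ‖1 - smoothStep c d x‖ ≤ 1 := by
  rw [smoothStep, ← Complex.ofReal_one, ← Complex.ofReal_sub, Complex.norm_real,
    Real.norm_of_nonneg (by linarith [Real.smoothTransition.le_one ((x - c) / (d - c))])]
  linarith [Real.smoothTransition.nonneg ((x - c) / (d - c))]

theorem exists_pair_interval {a b : EReal} (hab : a < b) :
    ∃ c d, c ∈ interval a b ∧ d ∈ interval a b ∧ c < d := by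
  obtain ⟨c, hc⟩ := nonempty_interval hab
  obtain ⟨d, hcd, hd⟩ := EReal.lt_iff_exists_real_btwn.1 hc.2
  exact ⟨c, d, hc, ⟨hc.1.trans hcd, hd⟩, EReal.coe_lt_coe_iff.1 hcd⟩

theorem wronskian_zero_right (v : ℝ → ℂ) : wronskian v 0 = 0 := by
  funext x
  simp [wronskian]

/-- The self-adjoint boundary condition at `b`: cutting off near `a` decouples the endpoints. -/
theorem tendsto_wronskian_star_right {a b : EReal} (hab : a < b) {q : ℝ → ℝ}
    {H : L2 a b →ₗ.[ℂ] L2 a b} (hH : IsSeparatedRealization a b q H) {v u : ℝ → ℂ}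
    (hp : IsBoundaryPair a b q H v u) {f g : ℝ → ℂ} (hf : MaxDomain a b q f)
    (hg : MaxDomain a b q g) (huf : Tendsto (wronskian u f) (toRight b) (𝓝 0))
    (hug : Tendsto (wronskian u g) (toRight b) (𝓝 0)) :
    Tendsto (wronskian (fun x => star (f x)) g) (toRight b) (𝓝 0) := by
  obtain ⟨c, d, hc, hd, hcd⟩ := exists_pair_interval hab
  have cut : ∀ {h : ℝ → ℂ}, MaxDomain a b q h →
      MaxDomain a b q (fun x => smoothStep c d x * h x) := fun hh =>
    hh.cutoff_mul (contDiff_smoothStep c d) (norm_smoothStep_le c d) hc hd (e := 0) (e' := 1)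
      (fun x hx => smoothStep_of_le hcd (le_of_lt hx))
      (fun x hx => smoothStep_of_ge hcd (le_of_lt hx))
  have hright : ∀ h : ℝ → ℂ,
      Set.EqOn (fun x => smoothStep c d x * h x) h (interval a b ∩ Set.Ioi d) := fun h x hx => by
    simp [smoothStep_of_ge hcd (le_of_lt hx.2)]
  have hleft : ∀ h : ℝ → ℂ,
      Set.EqOn (fun x => smoothStep c d x * h x) 0 (interval a b ∩ Set.Iio c) := fun h x hx => by
    simp [smoothStep_of_le hcd (le_of_lt hx.2)]
  have hva : ∀ h k : ℝ → ℂ,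
      Tendsto (wronskian h (fun x => smoothStep c d x * k x)) (toLeft a) (𝓝 0) := fun h k =>
    tendsto_wronskian_left_congr hc (hleft k)
      (by rw [wronskian_zero_right]; exact tendsto_const_nhds)
  have key := tendsto_wronskian_star_sub hab hH hp (cut hf) (cut hg) (hva v f)
    (tendsto_wronskian_right_congr hd (hright f) huf) (hva v g)
    (tendsto_wronskian_right_congr hd (hright g) hug)
  have key2 := key.add ((hva (fun x => star (smoothStep c d x * f x)) g).comp tendsto_fst)
  simp only [Function.comp_apply, sub_add_cancel, add_zero] at key2
  refine (tendsto_of_tendsto_prod_toRight hab key2).congr'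
    (eventually_wronskian_eq ((isOpen_interval a b).inter isOpen_Ioi) (eventually_toRight hd)
      (fun x hx => ?_) (hright g))
  have := hright f hx
  simp only at this ⊢
  rw [this]

theorem tendsto_wronskian_star_left {a b : EReal} (hab : a < b) {q : ℝ → ℝ}
    {H : L2 a b →ₗ.[ℂ] L2 a b} (hH : IsSeparatedRealization a b q H) {v u : ℝ → ℂ}
    (hp : IsBoundaryPair a b q H v u) {f g : ℝ → ℂ} (hf : MaxDomain a b q f)
    (hg : MaxDomain a b q g) (hvf : Tendsto (wronskian v f) (toLeft a) (𝓝 0))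
    (hvg : Tendsto (wronskian v g) (toLeft a) (𝓝 0)) :
    Tendsto (wronskian (fun x => star (f x)) g) (toLeft a) (𝓝 0) := by
  obtain ⟨c, d, hc, hd, hcd⟩ := exists_pair_interval hab
  have cut : ∀ {h : ℝ → ℂ}, MaxDomain a b q h →
      MaxDomain a b q (fun x => (1 - smoothStep c d x) * h x) := fun hh =>
    hh.cutoff_mul (contDiff_const.sub (contDiff_smoothStep c d)) (norm_one_sub_smoothStep_le c d)
      hc hd (e := 1) (e' := 0) (fun x hx => by simp [smoothStep_of_le hcd (le_of_lt hx)])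
      (fun x hx => by simp [smoothStep_of_ge hcd (le_of_lt hx)])
  have hright : ∀ h : ℝ → ℂ, Set.EqOn (fun x => (1 - smoothStep c d x) * h x) 0
      (interval a b ∩ Set.Ioi d) := fun h x hx => by
    simp [smoothStep_of_ge hcd (le_of_lt hx.2)]
  have hleft : ∀ h : ℝ → ℂ, Set.EqOn (fun x => (1 - smoothStep c d x) * h x) h
      (interval a b ∩ Set.Iio c) := fun h x hx => by
    simp [smoothStep_of_le hcd (le_of_lt hx.2)]
  have hub : ∀ h k : ℝ → ℂ,
      Tendsto (wronskian h (fun x => (1 - smoothStep c d x) * k x)) (toRight b) (𝓝 0) := fun h k =>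
    tendsto_wronskian_right_congr hd (hright k)
      (by rw [wronskian_zero_right]; exact tendsto_const_nhds)
  have key := tendsto_wronskian_star_sub hab hH hp (cut hf) (cut hg)
    (tendsto_wronskian_left_congr hc (hleft f) hvf) (hub u f)
    (tendsto_wronskian_left_congr hc (hleft g) hvg) (hub u g)
  have key2 := ((hub (fun x => star ((1 - smoothStep c d x) * f x)) g).comp tendsto_snd).sub key
  simp only [Function.comp_apply, sub_sub_cancel, sub_zero] at key2
  refine (tendsto_of_tendsto_prod_toLeft hab key2).congr'
    (eventually_wronskian_eq ((isOpen_interval a b).inter isOpen_Iio) (eventually_toLeft hc)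
      (fun x hx => ?_) (hleft g))
  have := hleft f hx
  simp only at this ⊢
  rw [this]

theorem tendsto_wronskian_star {l : Filter ℝ} {f g : ℝ → ℂ}
    (h : Tendsto (wronskian (fun x => star (f x)) g) l (𝓝 0)) :
    Tendsto (wronskian f (fun x => star (g x))) l (𝓝 0) := by
  have := (continuous_star.tendsto (0 : ℂ)).comp h
  rw [star_zero] at this
  refine this.congr fun x => ?_
  have := congrFun (wronskian_star (fun x => star (f x)) g) x
  simp only [star_star] at this
  exact this.symm

theorem wronskian_self (f : ℝ → ℂ) : wronskian f f = 0 := by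
  funext x
  simp only [wronskian, Pi.zero_apply]
  ring

/-- The boundary form vanishes on functions satisfying the boundary condition at `b`. As `u`
itself satisfies that condition, the condition is invariant under complex conjugation. -/
theorem tendsto_wronskian_right {a b : EReal} (hab : a < b) {q : ℝ → ℝ}
    {H : L2 a b →ₗ.[ℂ] L2 a b} (hH : IsSeparatedRealization a b q H) {v u : ℝ → ℂ}
    (hp : IsBoundaryPair a b q H v u) {f g : ℝ → ℂ} (hf : MaxDomain a b q f)
    (hg : MaxDomain a b q g) (huf : Tendsto (wronskian u f) (toRight b) (𝓝 0))
    (hug : Tendsto (wronskian u g) (toRight b) (𝓝 0)) :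
    Tendsto (wronskian f g) (toRight b) (𝓝 0) := by
  have huu : Tendsto (wronskian u u) (toRight b) (𝓝 0) := by
    rw [wronskian_self]; exact tendsto_const_nhds
  have := tendsto_wronskian_star (tendsto_wronskian_star_right hab hH hp hp.right hf huu huf)
  simpa only [star_star] using tendsto_wronskian_star_right hab hH hp hf.star hg this hug

theorem tendsto_wronskian_left {a b : EReal} (hab : a < b) {q : ℝ → ℝ}
    {H : L2 a b →ₗ.[ℂ] L2 a b} (hH : IsSeparatedRealization a b q H) {v u : ℝ → ℂ}
    (hp : IsBoundaryPair a b q H v u) {f g : ℝ → ℂ} (hf : MaxDomain a b q f)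
    (hg : MaxDomain a b q g) (hvf : Tendsto (wronskian v f) (toLeft a) (𝓝 0))
    (hvg : Tendsto (wronskian v g) (toLeft a) (𝓝 0)) :
    Tendsto (wronskian f g) (toLeft a) (𝓝 0) := by
  have hvv : Tendsto (wronskian v v) (toLeft a) (𝓝 0) := by
    rw [wronskian_self]; exact tendsto_const_nhds
  have := tendsto_wronskian_star (tendsto_wronskian_star_left hab hH hp hp.left hf hvv hvf)
  simpa only [star_star] using tendsto_wronskian_star_left hab hH hp hf.star hg this hvg

/-- At a point of the spectrum, solutions in the domain near `a` and near `b` have Wronskian zero: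
an eigenfunction has Wronskian zero with both. -/
theorem wronskian_eq_zero_of_mem_spectrum {a b : EReal} (hab : a < b) {q : ℝ → ℝ}
    {H : L2 a b →ₗ.[ℂ] L2 a b} (hH : IsSeparatedRealization a b q H) (hd : PurelyDiscrete H)
    {z : ℂ} (hz : z ∈ spectrum H) {f g : ℝ → ℂ} (hf : IsSolution a b q z f)
    (hg : IsSolution a b q z g) (hl : InDomainNearLeft H f) (hr : InDomainNearRight H g)
    {y : ℝ} (hy : y ∈ interval a b) : wronskian f g y = 0 := by
  obtain ⟨v, u, hp⟩ := hH.exists_isBoundaryPair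
  obtain ⟨k, hk, ⟨x, hx, hkx⟩, hkm, hvk, huk⟩ := exists_eigenfunction hH hd hp hz
  have hkg : wronskian k g x = 0 := by
    obtain ⟨G, c, hc, hG, hgG, huG⟩ := hp.exists_eqOn_right hg.locAC hr
    have h1 := tendsto_wronskian_right_congr hc hgG
      (tendsto_wronskian_right hab hH hp hkm hG huk huG)
    have h2 : Tendsto (wronskian k g) (toRight b) (𝓝 (wronskian k g x)) :=
      tendsto_const_nhds.congr' ((eventually_toRight hc).mono fun t ht =>
        (wronskian_eq_wronskian hk hg hx ht.1).symm)
    have := toRight_neBot hab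
    exact tendsto_nhds_unique h2 h1
  have hkf : wronskian k f x = 0 := by
    obtain ⟨F, c, hc, hF, hfF, hvF⟩ := hp.exists_eqOn_left hf.locAC hl
    have h1 := tendsto_wronskian_left_congr hc hfF
      (tendsto_wronskian_left hab hH hp hkm hF hvk hvF)
    have h2 : Tendsto (wronskian k f) (toLeft a) (𝓝 (wronskian k f x)) :=
      tendsto_const_nhds.congr' ((eventually_toLeft hc).mono fun t ht =>
        (wronskian_eq_wronskian hk hf hx ht.1).symm)
    have := toLeft_neBot hab
    exact tendsto_nhds_unique h2 h1
  rw [wronskian_eq_wronskian hf hg hx hy]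
  have hpl : k x * wronskian f g x = f x * wronskian k g x - g x * wronskian k f x := by
    simp only [wronskian]; ring
  rw [hkg, hkf, mul_zero, mul_zero, sub_zero] at hpl
  exact (mul_eq_zero.1 hpl).resolve_left hkx

end SingularWeyl

namespace SingularWeyl

/-! ### The Weyl solution as a multiple of `χ` -/

variable {a b : EReal} {q : ℝ → ℝ} {H : L2 a b →ₗ.[ℂ] L2 a b} {φ χ θ : ℂ → ℝ → ℂ} {M : ℂ → ℂ}

theorem MainHypothesis.interval_lt (hm : MainHypothesis a b q H φ χ) : a < b := by
  obtain ⟨z, x, hx, -⟩ := hm.nontrivial_right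
  exact hx.1.trans hx.2

/-- Cramer's rule for the fundamental system `θ(z)`, `φ(z)`. -/
theorem IsFundamentalSystem.cramer (hθ : IsFundamentalSystem a b q φ θ) (z : ℂ) (f : ℝ → ℂ)
    {x : ℝ} (hx : x ∈ interval a b) :
    f x = wronskian f (φ z) x * θ z x + wronskian (θ z) f x * φ z x := by
  have h := hθ.wronskian_eq z x hx
  calc f x = f x * wronskian (θ z) (φ z) x := by rw [h, mul_one]
    _ = _ := by simp only [wronskian]; ring

theorem IsFundamentalSystem.cramer_deriv (hθ : IsFundamentalSystem a b q φ θ) (z : ℂ)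
    (f : ℝ → ℂ) {x : ℝ} (hx : x ∈ interval a b) :
    deriv f x = wronskian f (φ z) x * deriv (θ z) x + wronskian (θ z) f x * deriv (φ z) x := by
  have h := hθ.wronskian_eq z x hx
  calc deriv f x = deriv f x * wronskian (θ z) (φ z) x := by rw [h, mul_one]
    _ = _ := by simp only [wronskian]; ring

theorem not_inDomainNearRight (hH : IsSeparatedRealization a b q H)
    (hm : MainHypothesis a b q H φ χ) (hθ : IsFundamentalSystem a b q φ θ) {z : ℂ}
    (hz : z ∈ resolventSet H) : ¬ InDomainNearRight H (φ z) := by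
  intro hr
  have h0 := eq_zero_of_mem_resolventSet hH hz (hm.entire_left.solution z) (hm.near_left z) hr
  obtain ⟨y, hy⟩ := nonempty_interval hm.interval_lt
  have h1 := hθ.wronskian_eq z y hy
  have h2 : deriv (φ z) y = 0 := by
    rw [(h0.eventuallyEq_of_mem ((isOpen_interval a b).mem_nhds hy)).deriv_eq]
    simp
  rw [wronskian, h2, h0 hy] at h1
  simp at h1

theorem wronskian_ne_zero_of_ne_zero (hH : IsSeparatedRealization a b q H)
    (hm : MainHypothesis a b q H φ χ) (hθ : IsFundamentalSystem a b q φ θ) {z : ℂ}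
    (hz : z ∈ resolventSet H) {x y : ℝ} (hx : x ∈ interval a b) (hy : y ∈ interval a b)
    (hχ : χ z x ≠ 0) : wronskian (φ z) (χ z) y ≠ 0 := by
  intro h0
  have hsol : ∀ t ∈ interval a b, χ z t = wronskian (θ z) (χ z) y * φ z t := fun t ht => by
    have h := hθ.cramer z (χ z) ht
    rw [wronskian_swap, wronskian_eq_wronskian (hm.entire_left.solution z)
      (hm.entire_right.solution z) hy ht, h0, wronskian_eq_wronskian (hθ.entire.solution z)
      (hm.entire_right.solution z) hy ht] at h
    rw [h]
    ring
  have hβ : wronskian (θ z) (χ z) y ≠ 0 := by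
    intro h
    apply hχ
    rw [hsol x hx, h, zero_mul]
  refine not_inDomainNearRight hH hm hθ hz
    (((hm.near_right z).const_mul (wronskian (θ z) (χ z) y)⁻¹).congr fun t ht => ?_)
  rw [hsol t ht, inv_mul_cancel_left₀ hβ]

/-- The Wronskian of `φ(z)` and `χ(z)` has no zeros in the resolvent set. If `χ(z) = 0`, the limit
condition at `b` makes the Wronskian vanish identically, contradicting
`wronskian_ne_zero_of_ne_zero` at a point of the resolvent set where `χ` does not vanish. -/
theorem wronskian_ne_zero (hH : IsSeparatedRealization a b q H)
    (hm : MainHypothesis a b q H φ χ) (hθ : IsFundamentalSystem a b q φ θ) {z : ℂ}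
    (hz : z ∈ resolventSet H) {y : ℝ} (hy : y ∈ interval a b) :
    wronskian (φ z) (χ z) y ≠ 0 := by
  by_cases hχ : ∃ x ∈ interval a b, χ z x ≠ 0
  · obtain ⟨x, hx, hne⟩ := hχ
    exact wronskian_ne_zero_of_ne_zero hH hm hθ hz hx hy hne
  exfalso
  push Not at hχ
  have hW : ∀ w, wronskian (φ w) (χ w) y = 0 := by
    intro w
    have := toRight_neBot hm.interval_lt
    refine tendsto_nhds_unique (hm.limit_right w z hz y hy) ?_
    have h0 : Tendsto (wronskian (φ w) 0) (toRight b) (𝓝 0) := by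
      rw [wronskian_zero_right]; exact tendsto_const_nhds
    exact tendsto_wronskian_right_congr hy (fun t ht => hχ t ht.1) h0
  obtain ⟨z₁, x, hx, hne⟩ := hm.nontrivial_right
  obtain ⟨ζ, hζ, hζx⟩ : ∃ ζ ∈ resolventSet H, χ ζ x ≠ 0 := by
    by_cases h1 : z₁ ∈ resolventSet H
    · exact ⟨z₁, h1, hne⟩
    · have h2 : ∀ᶠ ζ in 𝓝[≠] z₁, χ ζ x ≠ 0 :=
        ((hm.entire_right.entire x hx).continuous.continuousAt.eventually_ne hne).filter_mono
          nhdsWithin_le_nhds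
      exact ((hm.discrete z₁ h1).1.and h2).exists
  exact wronskian_ne_zero_of_ne_zero hH hm hθ hζ hx hy hζx (hW ζ)

theorem mem_resolventSet_iff (hH : IsSeparatedRealization a b q H)
    (hm : MainHypothesis a b q H φ χ) (hθ : IsFundamentalSystem a b q φ θ) {z : ℂ} {y : ℝ}
    (hy : y ∈ interval a b) : z ∈ resolventSet H ↔ wronskian (φ z) (χ z) y ≠ 0 := by
  refine ⟨fun hz => wronskian_ne_zero hH hm hθ hz hy, fun h => ?_⟩
  by_contra hz
  exact h (wronskian_eq_zero_of_mem_spectrum hm.interval_lt hH hm.discrete hz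
    (hm.entire_left.solution z) (hm.entire_right.solution z) (hm.near_left z) (hm.near_right z) hy)

theorem IsEntireSolution.differentiable_wronskian {f g : ℂ → ℝ → ℂ}
    (hf : IsEntireSolution a b q f) (hg : IsEntireSolution a b q g) {y : ℝ}
    (hy : y ∈ interval a b) : Differentiable ℂ (fun z => wronskian (f z) (g z) y) :=
  ((hf.entire y hy).mul (hg.entire_deriv y hy)).sub ((hf.entire_deriv y hy).mul (hg.entire y hy))

theorem isOpen_resolventSet (hH : IsSeparatedRealization a b q H)
    (hm : MainHypothesis a b q H φ χ) (hθ : IsFundamentalSystem a b q φ θ) :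
    IsOpen (resolventSet H) := by
  obtain ⟨y, hy⟩ := nonempty_interval hm.interval_lt
  have : resolventSet H = {z | wronskian (φ z) (χ z) y ≠ 0} :=
    Set.ext fun z => mem_resolventSet_iff hH hm hθ hy
  rw [this]
  exact isOpen_ne_fun
    (hm.entire_left.differentiable_wronskian hm.entire_right hy).continuous continuous_const

/-- On the resolvent set `ψ(z) = -χ(z) / W(z)`. -/
theorem weylSolution_eq (hH : IsSeparatedRealization a b q H)
    (hm : MainHypothesis a b q H φ χ) (hθ : IsFundamentalSystem a b q φ θ)
    (hM : IsSingularWeylFunction H φ θ M) {z : ℂ} (hz : z ∈ resolventSet H) {x y : ℝ}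
    (hx : x ∈ interval a b) (hy : y ∈ interval a b) :
    weylSolution φ θ M z x = -(wronskian (φ z) (χ z) y)⁻¹ * χ z x := by
  set W := wronskian (φ z) (χ z) y with hWdef
  set β := wronskian (θ z) (χ z) y with hβdef
  have hW : W ≠ 0 := wronskian_ne_zero hH hm hθ hz hy
  have hsol : ∀ t ∈ interval a b, χ z t = -W * θ z t + β * φ z t := fun t ht => by
    have h := hθ.cramer z (χ z) ht
    rwa [wronskian_swap, wronskian_eq_wronskian (hm.entire_left.solution z)
      (hm.entire_right.solution z) hy ht, wronskian_eq_wronskian (hθ.entire.solution z)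
      (hm.entire_right.solution z) hy ht] at h
  have hdiff : ∀ t ∈ interval a b,
      weylSolution φ θ M z t + W⁻¹ * χ z t = (M z + W⁻¹ * β) * φ z t := fun t ht => by
    rw [weylSolution, hsol t ht]
    field_simp
    ring
  -- The left-hand side of `hdiff` is in the domain near `b`, and `φ(z)` is not.
  have hcoef : M z + W⁻¹ * β = 0 := by
    by_contra hne
    refine not_inDomainNearRight hH hm hθ hz
      (((((hM z hz).add ((hm.near_right z).const_mul W⁻¹)).const_mul (M z + W⁻¹ * β)⁻¹)).congr
        fun t ht => ?_)
    rw [hdiff t ht, inv_mul_cancel_left₀ hne]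
  have := hdiff x hx
  rw [hcoef, zero_mul] at this
  linear_combination this

end SingularWeyl

namespace SingularWeyl

/-! ### Cauchy integrals depending on a real parameter -/

/-- The kernel of the Cauchy integral for the `j`-th derivative at `z`. -/
noncomputable def cauchyKernel (z : ℂ) (j : ℕ) (ζ : ℂ) : ℂ :=
  (j.factorial : ℂ) / (2 * Real.pi * Complex.I) / (ζ - z) ^ (j + 1)

theorem sub_ne_zero_of_mem_sphere {z ζ : ℂ} {R : ℝ} (hR : 0 < R) (hζ : ζ ∈ Metric.sphere z R) :
    ζ - z ≠ 0 := by
  intro h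
  rw [mem_sphere_iff_norm, h, norm_zero] at hζ
  exact hR.ne hζ

theorem continuousOn_cauchyKernel {z : ℂ} {R : ℝ} (hR : 0 < R) (j : ℕ) :
    ContinuousOn (cauchyKernel z j) (Metric.sphere z R) :=
  continuousOn_const.div ((continuousOn_id.sub continuousOn_const).pow _)
    fun _ hζ => pow_ne_zero _ (sub_ne_zero_of_mem_sphere hR hζ)

theorem iteratedDeriv_eq_circleIntegral {z : ℂ} {R : ℝ} (hR : 0 < R) {f : ℂ → ℂ}
    (hf : DifferentiableOn ℂ f (Metric.closedBall z R)) (j : ℕ) :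
    iteratedDeriv j f z = ∮ ζ in C(z, R), cauchyKernel z j ζ * f ζ := by
  have h := hf.circleIntegral_one_div_sub_center_pow_smul hR j
  have h2 : (fun ζ => cauchyKernel z j ζ * f ζ) = fun ζ =>
      ((j.factorial : ℂ) / (2 * Real.pi * Complex.I)) * ((1 / (ζ - z) ^ (j + 1)) • f ζ) := by
    funext ζ
    simp only [cauchyKernel, smul_eq_mul]
    ring
  have hj : (j.factorial : ℂ) ≠ 0 := by exact_mod_cast j.factorial_ne_zero
  rw [h2, circleIntegral.integral_const_mul, h, smul_eq_mul]
  have := Complex.two_pi_I_ne_zero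
  field_simp

/-- The Leibniz rule for `(ζ - w) f(ζ)`, in terms of Cauchy integrals. -/
theorem circleIntegral_cauchyKernel_sub_mul {z : ℂ} {R : ℝ} (hR : 0 < R) {f : ℂ → ℂ}
    (hf : DifferentiableOn ℂ f (Metric.closedBall z R)) (w : ℂ) (j : ℕ) :
    ∮ ζ in C(z, R), cauchyKernel z j ζ * ((ζ - w) * f ζ) =
      (z - w) * iteratedDeriv j f z + j * iteratedDeriv (j - 1) f z := by
  have hfc : ContinuousOn f (Metric.sphere z R) :=
    hf.continuousOn.mono Metric.sphere_subset_closedBall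
  have hK := continuousOn_cauchyKernel (z := z) hR j
  have hsplit : (∮ ζ in C(z, R), cauchyKernel z j ζ * ((ζ - w) * f ζ)) =
      (∮ ζ in C(z, R), (z - w) * (cauchyKernel z j ζ * f ζ)) +
        ∮ ζ in C(z, R), cauchyKernel z j ζ * ((ζ - z) * f ζ) := by
    rw [← circleIntegral.integral_add]
    · exact circleIntegral.integral_congr hR.le fun ζ _ => by ring
    · exact (continuousOn_const.mul (hK.mul hfc)).circleIntegrable hR.le
    · exact (hK.mul ((continuousOn_id.sub continuousOn_const).mul hfc)).circleIntegrable hR.le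
  rw [hsplit, circleIntegral.integral_const_mul, ← iteratedDeriv_eq_circleIntegral hR hf]
  congr 1
  cases j with
  | zero =>
    have h0 : ∮ ζ in C(z, R), f ζ = 0 :=
      (hf.mono Metric.closure_ball_subset_closedBall).diffContOnCl.circleIntegral_eq_zero hR.le
    rw [circleIntegral.integral_congr (g := fun ζ => 1 / (2 * Real.pi * Complex.I) * f ζ) hR.le,
      circleIntegral.integral_const_mul, h0]
    · simp
    · intro ζ hζ
      have := sub_ne_zero_of_mem_sphere hR hζ
      simp only [cauchyKernel]
      field_simp
      simp
  | succ j =>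
    rw [circleIntegral.integral_congr
      (g := fun ζ => ((j + 1 : ℕ) : ℂ) * (cauchyKernel z j ζ * f ζ)) hR.le,
      circleIntegral.integral_const_mul, ← iteratedDeriv_eq_circleIntegral hR hf,
      Nat.add_sub_cancel]
    intro ζ hζ
    have := sub_ne_zero_of_mem_sphere hR hζ
    simp only [cauchyKernel, Nat.factorial_succ, Nat.cast_mul]
    field_simp
    ring

theorem aestronglyMeasurable_circle {z : ℂ} {R : ℝ} (hR : 0 ≤ R) {g : ℂ → ℂ}
    (hg : ContinuousOn g (Metric.sphere z R)) (μ : Measure ℝ) :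
    AEStronglyMeasurable (fun t : ℝ => deriv (circleMap z R) t • g (circleMap z R t)) μ := by
  have h1 : Continuous (fun t => g (circleMap z R t)) :=
    hg.comp_continuous (continuous_circleMap z R) fun t => circleMap_mem_sphere z hR t
  have h2 : Continuous (deriv (circleMap z R)) :=
    (contDiff_circleMap z R (n := 1)).continuous_deriv le_rfl
  exact (h2.smul h1).aestronglyMeasurable

theorem norm_circle_le {z : ℂ} {R : ℝ} (hR : 0 ≤ R) {C : ℝ} {g : ℂ → ℂ}
    (hg : ∀ ζ ∈ Metric.sphere z R, ‖g ζ‖ ≤ C) (t : ℝ) :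
    ‖deriv (circleMap z R) t • g (circleMap z R t)‖ ≤ R * C := by
  rw [norm_smul, deriv_circleMap, norm_mul, Complex.norm_I, mul_one, norm_circleMap_zero,
    abs_of_nonneg hR]
  exact mul_le_mul_of_nonneg_left (hg _ (circleMap_mem_sphere z hR t)) hR

theorem hasDerivAt_circleIntegral {G G' : ℂ → ℝ → ℂ} {z : ℂ} {R : ℝ} (hR : 0 ≤ R) {x₀ : ℝ}
    {s : Set ℝ} (hs : s ∈ 𝓝 x₀) {C : ℝ}
    (hG : ∀ x ∈ s, ContinuousOn (fun ζ => G ζ x) (Metric.sphere z R))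
    (hG' : ContinuousOn (fun ζ => G' ζ x₀) (Metric.sphere z R))
    (hd : ∀ ζ ∈ Metric.sphere z R, ∀ x ∈ s, HasDerivAt (G ζ) (G' ζ x) x)
    (hC : ∀ ζ ∈ Metric.sphere z R, ∀ x ∈ s, ‖G' ζ x‖ ≤ C) :
    HasDerivAt (fun x => ∮ ζ in C(z, R), G ζ x) (∮ ζ in C(z, R), G' ζ x₀) x₀ := by
  unfold circleIntegral
  refine (intervalIntegral.hasDerivAt_integral_of_dominated_loc_of_deriv_le
    (F := fun x t => deriv (circleMap z R) t • G (circleMap z R t) x)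
    (F' := fun x t => deriv (circleMap z R) t • G' (circleMap z R t) x)
    (bound := fun _ => R * C) hs ?_ ?_ ?_ ?_ ?_ ?_).2
  · filter_upwards [hs] with x hx using aestronglyMeasurable_circle hR (hG x hx) _
  · exact ((hG x₀ (mem_of_mem_nhds hs)).circleIntegrable hR).out
  · exact aestronglyMeasurable_circle hR hG' _
  · exact ae_of_all _ fun t _ x hx =>
      norm_circle_le hR (g := fun ζ => G' ζ x) (fun ζ hζ => hC ζ hζ x hx) t
  · exact intervalIntegrable_const
  · exact ae_of_all _ fun t _ x hx =>
      (hd _ (circleMap_mem_sphere z hR t) x hx).fun_const_smul _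

theorem tendsto_circleIntegral {l : Filter ℝ} [l.IsCountablyGenerated] {G : ℂ → ℝ → ℂ}
    {g : ℂ → ℂ} {z : ℂ} {R : ℝ} (hR : 0 ≤ R) {C : ℝ}
    (hG : ∀ᶠ x in l, ContinuousOn (fun ζ => G ζ x) (Metric.sphere z R))
    (hC : ∀ᶠ x in l, ∀ ζ ∈ Metric.sphere z R, ‖G ζ x‖ ≤ C)
    (hl : ∀ ζ ∈ Metric.sphere z R, Tendsto (G ζ) l (𝓝 (g ζ))) :
    Tendsto (fun x => ∮ ζ in C(z, R), G ζ x) l (𝓝 (∮ ζ in C(z, R), g ζ)) := by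
  unfold circleIntegral
  refine intervalIntegral.tendsto_integral_filter_of_dominated_convergence (fun _ => R * C)
    ?_ ?_ intervalIntegrable_const ?_
  · filter_upwards [hG] with x hx using aestronglyMeasurable_circle hR hx _
  · filter_upwards [hC] with x hx
    exact ae_of_all _ fun t _ => norm_circle_le hR (g := fun ζ => G ζ x) hx t
  · exact ae_of_all _ fun t _ => (hl _ (circleMap_mem_sphere z hR t)).const_smul _

/-! ### Locally uniform bounds for entire solutions -/

variable {a b : EReal} {q : ℝ → ℝ} {φ θ χ : ℂ → ℝ → ℂ}

/-- Variation of parameters: the Wronskians of `χ(ζ)` with a fundamental system at the spectral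
parameter `0` solve a linear system with continuous coefficients, to which Gronwall's inequality
applies. -/
theorem exists_bound_entireSolution (hθ : IsFundamentalSystem a b q φ θ)
    (hφ : IsEntireSolution a b q φ) (hχ : IsEntireSolution a b q χ) {c d : ℝ}
    (hc : c ∈ interval a b) (hd : d ∈ interval a b) (hcd : c ≤ d) {S : Set ℂ}
    (hS : IsCompact S) :
    ∃ C, ∀ ζ ∈ S, ∀ x ∈ Set.Icc c d, ‖χ ζ x‖ ≤ C ∧ ‖deriv (χ ζ) x‖ ≤ C := by
  have hI : Set.Icc c d ⊆ interval a b := Set.Icc_subset_uIcc.trans (uIcc_subset_interval hc hd)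
  have bd : ∀ f : ℝ → ℂ, ContinuousOn f (interval a b) → ∃ m, ∀ x ∈ Set.Icc c d, ‖f x‖ ≤ m :=
    fun f hf => isCompact_Icc.exists_bound_of_continuousOn (hf.mono hI)
  obtain ⟨m₁, h₁⟩ := bd _ (hθ.entire.solution 0).locAC.continuousOn
  obtain ⟨m₂, h₂⟩ := bd _ (hθ.entire.solution 0).locAC.continuousOn_deriv
  obtain ⟨m₃, h₃⟩ := bd _ (hφ.solution 0).locAC.continuousOn
  obtain ⟨m₄, h₄⟩ := bd _ (hφ.solution 0).locAC.continuousOn_deriv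
  set m := max (max m₁ m₂) (max m₃ m₄) with hm
  have g₁ : ∀ x ∈ Set.Icc c d, ‖θ 0 x‖ ≤ m := fun x hx => (h₁ x hx).trans (by simp [hm])
  have g₂ : ∀ x ∈ Set.Icc c d, ‖deriv (θ 0) x‖ ≤ m := fun x hx => (h₂ x hx).trans (by simp [hm])
  have g₃ : ∀ x ∈ Set.Icc c d, ‖φ 0 x‖ ≤ m := fun x hx => (h₃ x hx).trans (by simp [hm])
  have g₄ : ∀ x ∈ Set.Icc c d, ‖deriv (φ 0) x‖ ≤ m := fun x hx => (h₄ x hx).trans (by simp [hm])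
  have hm0 : 0 ≤ m := (norm_nonneg _).trans (g₁ c ⟨le_rfl, hcd⟩)
  obtain ⟨r, hr⟩ := hS.exists_bound_of_continuousOn (f := fun ζ : ℂ => ζ) continuousOn_id
  set Y : ℂ → ℝ → ℂ × ℂ := fun ζ x => (wronskian (χ ζ) (φ 0) x, wronskian (θ 0) (χ ζ) x) with hY
  have hYc : ContinuousOn (fun ζ => Y ζ c) S := by
    refine (Continuous.prodMk ?_ ?_).continuousOn
    · exact ((hχ.entire c hc).continuous.mul continuous_const).sub
        ((hχ.entire_deriv c hc).continuous.mul continuous_const)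
    · exact (continuous_const.mul (hχ.entire_deriv c hc).continuous).sub
        (continuous_const.mul (hχ.entire c hc).continuous)
  obtain ⟨δ, hδ⟩ := hS.exists_bound_of_continuousOn hYc
  have hcomb : ∀ (u v : ℂ) (p : ℂ × ℂ), ‖u‖ ≤ m → ‖v‖ ≤ m →
      ‖p.1 * u + p.2 * v‖ ≤ 2 * m * ‖p‖ := by
    intro u v p hu hv
    calc ‖p.1 * u + p.2 * v‖ ≤ ‖p.1‖ * ‖u‖ + ‖p.2‖ * ‖v‖ := by
          rw [← norm_mul, ← norm_mul]; exact norm_add_le _ _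
      _ ≤ ‖p‖ * m + ‖p‖ * m := by
          gcongr
          · exact norm_fst_le p
          · exact norm_snd_le p
      _ = 2 * m * ‖p‖ := by ring
  have hχY : ∀ ζ, ∀ x ∈ Set.Icc c d, ‖χ ζ x‖ ≤ 2 * m * ‖Y ζ x‖ := fun ζ x hx => by
    rw [hθ.cramer 0 (χ ζ) (hI hx)]
    exact hcomb _ _ (Y ζ x) (g₁ x hx) (g₃ x hx)
  have hχY' : ∀ ζ, ∀ x ∈ Set.Icc c d, ‖deriv (χ ζ) x‖ ≤ 2 * m * ‖Y ζ x‖ := fun ζ x hx => by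
    rw [hθ.cramer_deriv 0 (χ ζ) (hI hx)]
    exact hcomb _ _ (Y ζ x) (g₂ x hx) (g₄ x hx)
  set K := r * m * (2 * m) with hK
  refine ⟨2 * m * (δ * Real.exp (|K| * (d - c))), fun ζ hζ x hx => ?_⟩
  have hr0 : 0 ≤ r := (norm_nonneg _).trans (hr ζ hζ)
  have hδ0 : 0 ≤ δ := (norm_nonneg _).trans (hδ ζ hζ)
  have hder : ∀ t ∈ Set.Icc c d, HasDerivAt (Y ζ)
      ((ζ - 0) * (χ ζ t * φ 0 t), (0 - ζ) * (θ 0 t * χ ζ t)) t := fun t ht =>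
    (hasDerivAt_wronskian (hχ.solution ζ) (hφ.solution 0) (hI ht)).prodMk
      (hasDerivAt_wronskian (hθ.entire.solution 0) (hχ.solution ζ) (hI ht))
  have hgr := norm_le_gronwallBound_of_norm_deriv_right_le (f := Y ζ) (K := K) (ε := 0) (δ := δ)
    (fun t ht => (hder t ht).continuousAt.continuousWithinAt)
    (fun t ht => (hder t ⟨ht.1, ht.2.le⟩).hasDerivWithinAt) (hδ ζ hζ) (fun t ht => by
      have ht' : t ∈ Set.Icc c d := ⟨ht.1, ht.2.le⟩
      have e1 : ‖(ζ - 0) * (χ ζ t * φ 0 t)‖ ≤ r * ((2 * m * ‖Y ζ t‖) * m) := by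
        rw [norm_mul, norm_mul, sub_zero]
        gcongr
        · exact hr ζ hζ
        · exact hχY ζ t ht'
        · exact g₃ t ht'
      have e2 : ‖(0 - ζ) * (θ 0 t * χ ζ t)‖ ≤ r * (m * (2 * m * ‖Y ζ t‖)) := by
        rw [norm_mul, norm_mul, zero_sub, norm_neg]
        gcongr
        · exact hr ζ hζ
        · exact g₁ t ht'
        · exact hχY ζ t ht'
      rw [add_zero, hK]
      refine (norm_prod_le_iff).2 ⟨e1.trans_eq (by ring), e2.trans_eq (by ring)⟩) x hx
  rw [gronwallBound_ε0] at hgr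
  have hfin : ‖Y ζ x‖ ≤ δ * Real.exp (|K| * (d - c)) := by
    refine hgr.trans (mul_le_mul_of_nonneg_left (Real.exp_le_exp.2 ?_) hδ0)
    exact mul_le_mul (le_abs_self K) (by linarith [hx.2]) (by linarith [hx.1]) (abs_nonneg K)
  have hfin' := mul_le_mul_of_nonneg_left hfin (by positivity : 0 ≤ 2 * m)
  exact ⟨(hχY ζ x hx).trans hfin', (hχY' ζ x hx).trans hfin'⟩

end SingularWeyl

namespace SingularWeyl

/-! ### Derivatives of the Weyl solution with respect to the spectral parameter -/

variable {a b : EReal} {q : ℝ → ℝ} {H : L2 a b →ₗ.[ℂ] L2 a b} {φ χ θ : ℂ → ℝ → ℂ} {M : ℂ → ℂ}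

theorem differentiableOn_weylSolution (hH : IsSeparatedRealization a b q H)
    (hm : MainHypothesis a b q H φ χ) (hθ : IsFundamentalSystem a b q φ θ)
    (hM : IsSingularWeylFunction H φ θ M) {x : ℝ} (hx : x ∈ interval a b) :
    DifferentiableOn ℂ (fun z => weylSolution φ θ M z x) (resolventSet H) := by
  have h : DifferentiableOn ℂ (fun z => -(wronskian (φ z) (χ z) x)⁻¹ * χ z x) (resolventSet H) :=
    DifferentiableOn.mul (DifferentiableOn.neg (DifferentiableOn.inv
      (hm.entire_left.differentiable_wronskian hm.entire_right hx).differentiableOn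
      fun z hz => wronskian_ne_zero hH hm hθ hz hx)) (hm.entire_right.entire x hx).differentiableOn
  exact h.congr fun z hz => weylSolution_eq hH hm hθ hM hz hx hx

/-- The kernel of the Cauchy integral which expresses `ψ^{(j)}(z)` by `χ`. -/
noncomputable def weylKernel (φ χ : ℂ → ℝ → ℂ) (y : ℝ) (z : ℂ) (j : ℕ) (ζ : ℂ) : ℂ :=
  cauchyKernel z j ζ * -(wronskian (φ ζ) (χ ζ) y)⁻¹

theorem continuousOn_weylKernel (hH : IsSeparatedRealization a b q H)
    (hm : MainHypothesis a b q H φ χ) (hθ : IsFundamentalSystem a b q φ θ) {y : ℝ}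
    (hy : y ∈ interval a b) {z : ℂ} {R : ℝ} (hR : 0 < R)
    (hRz : Metric.closedBall z R ⊆ resolventSet H) (j : ℕ) :
    ContinuousOn (weylKernel φ χ y z j) (Metric.sphere z R) :=
  (continuousOn_cauchyKernel hR j).mul (ContinuousOn.neg (ContinuousOn.inv₀
    (hm.entire_left.differentiable_wronskian hm.entire_right hy).continuous.continuousOn
    fun _ hζ => wronskian_ne_zero hH hm hθ (hRz (Metric.sphere_subset_closedBall hζ)) hy))

theorem weylDeriv_eq_circleIntegral (hH : IsSeparatedRealization a b q H)
    (hm : MainHypothesis a b q H φ χ) (hθ : IsFundamentalSystem a b q φ θ)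
    (hM : IsSingularWeylFunction H φ θ M) {x y : ℝ} (hx : x ∈ interval a b)
    (hy : y ∈ interval a b) {z : ℂ} {R : ℝ} (hR : 0 < R)
    (hRz : Metric.closedBall z R ⊆ resolventSet H) (j : ℕ) :
    weylDeriv φ θ M j z x = ∮ ζ in C(z, R), weylKernel φ χ y z j ζ * χ ζ x := by
  rw [weylDeriv, iteratedDeriv_eq_circleIntegral hR
    ((differentiableOn_weylSolution hH hm hθ hM hx).mono hRz)]
  refine circleIntegral.integral_congr hR.le fun ζ hζ => ?_
  simp only [weylKernel]
  rw [weylSolution_eq hH hm hθ hM (hRz (Metric.sphere_subset_closedBall hζ)) hx hy]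
  ring

theorem hasDerivAt_weylDeriv (hH : IsSeparatedRealization a b q H)
    (hm : MainHypothesis a b q H φ χ) (hθ : IsFundamentalSystem a b q φ θ)
    (hM : IsSingularWeylFunction H φ θ M) {x y : ℝ} (hx : x ∈ interval a b)
    (hy : y ∈ interval a b) {z : ℂ} {R : ℝ} (hR : 0 < R)
    (hRz : Metric.closedBall z R ⊆ resolventSet H) (j : ℕ) :
    HasDerivAt (weylDeriv φ θ M j z)
      (∮ ζ in C(z, R), weylKernel φ χ y z j ζ * deriv (χ ζ) x) x := by
  have hκ := continuousOn_weylKernel hH hm hθ hy hR hRz j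
  obtain ⟨c, d, hxcd, hn, hcd⟩ :=
    exists_Icc_mem_subset_of_mem_nhds ((isOpen_interval a b).mem_nhds hx)
  have hle : c ≤ d := hxcd.1.trans hxcd.2
  obtain ⟨C, hC⟩ := exists_bound_entireSolution hθ hm.entire_left hm.entire_right
    (hcd ⟨le_rfl, hle⟩) (hcd ⟨hle, le_rfl⟩) hle (isCompact_sphere z R)
  obtain ⟨C', hC'⟩ := (isCompact_sphere z R).exists_bound_of_continuousOn hκ
  have h := hasDerivAt_circleIntegral (G := fun ζ x => weylKernel φ χ y z j ζ * χ ζ x)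
    (G' := fun ζ x => weylKernel φ χ y z j ζ * deriv (χ ζ) x) (C := C' * C) hR.le hn
    (fun t ht => hκ.mul (hm.entire_right.entire t (hcd ht)).continuous.continuousOn)
    (hκ.mul (hm.entire_right.entire_deriv x hx).continuous.continuousOn)
    (fun ζ _ t ht => ((hm.entire_right.solution ζ).locAC.hasDerivAt (hcd ht)).const_mul _)
    (fun ζ hζ t ht => by
      rw [norm_mul]
      exact mul_le_mul (hC' ζ hζ) (hC ζ hζ t ht).2 (norm_nonneg _)
        ((norm_nonneg _).trans (hC' ζ hζ)))
  refine h.congr_of_eventuallyEq ?_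
  filter_upwards [(isOpen_interval a b).mem_nhds hx] with t ht
  exact weylDeriv_eq_circleIntegral hH hm hθ hM ht hy hR hRz j

theorem continuousOn_weylDeriv (hH : IsSeparatedRealization a b q H)
    (hm : MainHypothesis a b q H φ χ) (hθ : IsFundamentalSystem a b q φ θ)
    (hM : IsSingularWeylFunction H φ θ M) {z : ℂ} {R : ℝ} (hR : 0 < R)
    (hRz : Metric.closedBall z R ⊆ resolventSet H) (j : ℕ) :
    ContinuousOn (weylDeriv φ θ M j z) (interval a b) := fun _ hx =>
  (hasDerivAt_weylDeriv hH hm hθ hM hx hx hR hRz j).continuousAt.continuousWithinAt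

theorem wronskian_weylDeriv_eq (hH : IsSeparatedRealization a b q H)
    (hm : MainHypothesis a b q H φ χ) (hθ : IsFundamentalSystem a b q φ θ)
    (hM : IsSingularWeylFunction H φ θ M) {x y : ℝ} (hx : x ∈ interval a b)
    (hy : y ∈ interval a b) {z : ℂ} {R : ℝ} (hR : 0 < R)
    (hRz : Metric.closedBall z R ⊆ resolventSet H) (j : ℕ) (f : ℝ → ℂ) :
    wronskian (weylDeriv φ θ M j z) f x =
      ∮ ζ in C(z, R), weylKernel φ χ y z j ζ * wronskian (χ ζ) f x := by
  have hκ := continuousOn_weylKernel hH hm hθ hy hR hRz j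
  rw [wronskian, (hasDerivAt_weylDeriv hH hm hθ hM hx hy hR hRz j).deriv,
    weylDeriv_eq_circleIntegral hH hm hθ hM hx hy hR hRz j, mul_comm _ (deriv f x),
    mul_comm _ (f x), ← circleIntegral.integral_const_mul, ← circleIntegral.integral_const_mul,
    ← circleIntegral.integral_sub]
  · exact circleIntegral.integral_congr hR.le fun ζ _ => by simp only [wronskian]; ring
  · exact (continuousOn_const.mul (hκ.mul
      (hm.entire_right.entire x hx).continuous.continuousOn)).circleIntegrable hR.le
  · exact (continuousOn_const.mul (hκ.mul
      (hm.entire_right.entire_deriv x hx).continuous.continuousOn)).circleIntegrable hR.le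

theorem continuous_wronskian_right (hm : MainHypothesis a b q H φ χ) (f : ℝ → ℂ) {x : ℝ}
    (hx : x ∈ interval a b) : Continuous fun ζ => wronskian (χ ζ) f x :=
  ((hm.entire_right.entire x hx).continuous.mul continuous_const).sub
    ((hm.entire_right.entire_deriv x hx).continuous.mul continuous_const)

/-- The derivative in `x` of `W_x(ψ^{(j)}(z), φ(w))`. It reflects the equation
`τ ψ^{(j)} = z ψ^{(j)} + j ψ^{(j-1)}`, obtained by differentiating `τ ψ = z ψ` in `z`. -/
theorem hasDerivAt_wronskian_weylDeriv (hH : IsSeparatedRealization a b q H)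
    (hm : MainHypothesis a b q H φ χ) (hθ : IsFundamentalSystem a b q φ θ)
    (hM : IsSingularWeylFunction H φ θ M) {x : ℝ} (hx : x ∈ interval a b) {z : ℂ} {R : ℝ}
    (hR : 0 < R) (hRz : Metric.closedBall z R ⊆ resolventSet H) (j : ℕ) (w : ℂ) :
    HasDerivAt (wronskian (weylDeriv φ θ M j z) (φ w))
      ((z - w) * (φ w x * weylDeriv φ θ M j z x) +
        j * (φ w x * weylDeriv φ θ M (j - 1) z x)) x := by
  have hκ := continuousOn_weylKernel hH hm hθ hx hR hRz j
  obtain ⟨c, d, hxcd, hn, hcd⟩ :=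
    exists_Icc_mem_subset_of_mem_nhds ((isOpen_interval a b).mem_nhds hx)
  have hle : c ≤ d := hxcd.1.trans hxcd.2
  obtain ⟨C, hC⟩ := exists_bound_entireSolution hθ hm.entire_left hm.entire_right
    (hcd ⟨le_rfl, hle⟩) (hcd ⟨hle, le_rfl⟩) hle (isCompact_sphere z R)
  obtain ⟨C', hC'⟩ := (isCompact_sphere z R).exists_bound_of_continuousOn
    (hκ.mul (continuousOn_id.sub (continuousOn_const (c := w))))
  obtain ⟨m, hm'⟩ := isCompact_Icc.exists_bound_of_continuousOn
    ((hm.entire_left.solution w).locAC.continuousOn.mono hcd)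
  have h := hasDerivAt_circleIntegral
    (G := fun ζ t => weylKernel φ χ x z j ζ * wronskian (χ ζ) (φ w) t)
    (G' := fun ζ t => weylKernel φ χ x z j ζ * ((ζ - w) * (χ ζ t * φ w t))) (C := C' * (C * m))
    hR.le hn
    (fun t ht => hκ.mul (continuous_wronskian_right hm (φ w) (hcd ht)).continuousOn)
    (hκ.mul ((continuousOn_id.sub continuousOn_const).mul
      ((hm.entire_right.entire x hx).continuous.continuousOn.mul continuousOn_const)))
    (fun ζ _ t ht => (hasDerivAt_wronskian (hm.entire_right.solution ζ)
      (hm.entire_left.solution w) (hcd ht)).const_mul _)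
    (fun ζ hζ t ht => by
      rw [← mul_assoc, norm_mul, norm_mul (χ ζ t)]
      have h1 := (hC ζ hζ t ht).1
      exact mul_le_mul (hC' ζ hζ)
        (mul_le_mul h1 (hm' t ht) (norm_nonneg _) ((norm_nonneg _).trans h1))
        (by positivity) ((norm_nonneg _).trans (hC' ζ hζ)))
  have hval : ∮ ζ in C(z, R), weylKernel φ χ x z j ζ * ((ζ - w) * (χ ζ x * φ w x)) =
      (z - w) * (φ w x * weylDeriv φ θ M j z x) +
        j * (φ w x * weylDeriv φ θ M (j - 1) z x) := by
    have hL := circleIntegral_cauchyKernel_sub_mul hR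
      ((differentiableOn_weylSolution hH hm hθ hM hx).mono hRz) w j
    rw [circleIntegral.integral_congr (g := fun ζ => φ w x *
      (cauchyKernel z j ζ * ((ζ - w) * weylSolution φ θ M ζ x))) hR.le,
      circleIntegral.integral_const_mul, hL]
    · simp only [weylDeriv]
      ring
    · intro ζ hζ
      simp only [weylKernel]
      rw [weylSolution_eq hH hm hθ hM (hRz (Metric.sphere_subset_closedBall hζ)) hx hx]
      ring
  rw [← hval]
  refine h.congr_of_eventuallyEq ?_
  filter_upwards [(isOpen_interval a b).mem_nhds hx] with t ht
  exact wronskian_weylDeriv_eq hH hm hθ hM ht hx hR hRz j (φ w)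

/-! ### Domination and limits at the endpoints -/

theorem exists_dominating (hm : MainHypothesis a b q H φ χ) {z : ℂ} {R : ℝ}
    (hRz : Metric.closedBall z R ⊆ resolventSet H) (w : ℂ) :
    ∃ F : ℝ → ℝ, Integrable F (leb a b) ∧
      ∀ ζ ∈ Metric.sphere z R, ∀ x ∈ interval a b, ‖φ w x * χ ζ x‖ ≤ F x := by
  obtain ⟨F, hF, hb⟩ := hm.dominated ({w} ×ˢ Metric.sphere z R)
    (isCompact_singleton.prod (isCompact_sphere z R))
    (Set.prod_mono (Set.subset_univ _) (Metric.sphere_subset_closedBall.trans hRz))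
  exact ⟨F, hF, fun ζ hζ x hx => hb (w, ζ) ⟨rfl, hζ⟩ x hx⟩

theorem integrable_mul_weylDeriv (hH : IsSeparatedRealization a b q H)
    (hm : MainHypothesis a b q H φ χ) (hθ : IsFundamentalSystem a b q φ θ)
    (hM : IsSingularWeylFunction H φ θ M) {z : ℂ} {R : ℝ} (hR : 0 < R)
    (hRz : Metric.closedBall z R ⊆ resolventSet H) (j : ℕ) (w : ℂ) :
    Integrable (fun x => φ w x * weylDeriv φ θ M j z x) (leb a b) := by
  obtain ⟨y, hy⟩ := nonempty_interval hm.interval_lt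
  have hκ := continuousOn_weylKernel hH hm hθ hy hR hRz j
  obtain ⟨C, hC⟩ := (isCompact_sphere z R).exists_bound_of_continuousOn hκ
  obtain ⟨F, hF, hb⟩ := exists_dominating hm hRz w
  refine (hF.const_mul (2 * Real.pi * R * C)).mono'
    (((hm.entire_left.solution w).locAC.continuousOn.mul
      (continuousOn_weylDeriv hH hm hθ hM hR hRz j)).aestronglyMeasurable
        (measurableSet_interval a b)) ?_
  filter_upwards [ae_restrict_mem (measurableSet_interval a b)] with x hx
  rw [weylDeriv_eq_circleIntegral hH hm hθ hM hx hy hR hRz j,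
    ← circleIntegral.integral_const_mul, mul_assoc (2 * Real.pi * R)]
  refine circleIntegral.norm_integral_le_of_norm_le_const hR.le fun ζ hζ => ?_
  rw [mul_left_comm, norm_mul]
  exact mul_le_mul (hC ζ hζ) (hb ζ hζ x hx) (norm_nonneg _) ((norm_nonneg _).trans (hC ζ hζ))

/-- The Wronskians `W_x(χ(ζ), φ(w))` are bounded up to both endpoints: their derivative
`(ζ - w) χ(ζ) φ(w)` is dominated by an integrable function. -/
theorem exists_bound_wronskian (hm : MainHypothesis a b q H φ χ) {z : ℂ} {R : ℝ}
    (hRz : Metric.closedBall z R ⊆ resolventSet H) (w : ℂ) :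
    ∃ C, ∀ x ∈ interval a b, ∀ ζ ∈ Metric.sphere z R, ‖wronskian (χ ζ) (φ w) x‖ ≤ C := by
  obtain ⟨y, hy⟩ := nonempty_interval hm.interval_lt
  obtain ⟨F, hF, hb⟩ := exists_dominating hm hRz w
  obtain ⟨C₁, h₁⟩ := (isCompact_sphere z R).exists_bound_of_continuousOn
    (continuous_wronskian_right hm (φ w) hy).continuousOn
  obtain ⟨C₂, h₂⟩ := (isCompact_sphere z R).exists_bound_of_continuousOn
    (f := fun ζ => ζ - w) (continuousOn_id.sub continuousOn_const)
  refine ⟨C₁ + ∫ x in interval a b, C₂ * F x, fun x hx ζ hζ => ?_⟩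
  have hd := wronskian_sub_wronskian (hm.entire_right.solution ζ) (hm.entire_left.solution w) hy hx
  rw [sub_eq_iff_eq_add'] at hd
  rw [hd]
  refine (norm_add_le _ _).trans (add_le_add (h₁ ζ hζ) ?_)
  have hpt : ∀ t ∈ interval a b, ‖(ζ - w) * (χ ζ t * φ w t)‖ ≤ C₂ * F t := fun t ht => by
    rw [norm_mul, mul_comm (χ ζ t)]
    exact mul_le_mul (h₂ ζ hζ) (hb ζ hζ t ht) (norm_nonneg _) ((norm_nonneg _).trans (h₂ ζ hζ))
  have hsub : Set.uIoc y x ⊆ interval a b :=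
    Set.uIoc_subset_uIcc.trans (uIcc_subset_interval hy hx)
  have hFi : IntegrableOn (fun t => C₂ * F t) (interval a b) := hF.const_mul C₂
  calc ‖∫ t in y..x, (ζ - w) * (χ ζ t * φ w t)‖
      ≤ ∫ t in Set.uIoc y x, ‖(ζ - w) * (χ ζ t * φ w t)‖ :=
        intervalIntegral.norm_integral_le_integral_norm_uIoc
    _ ≤ ∫ t in Set.uIoc y x, C₂ * F t := by
        refine integral_mono_of_nonneg (ae_of_all _ fun t => norm_nonneg _)
          (hFi.mono_set hsub) ?_
        filter_upwards [ae_restrict_mem measurableSet_uIoc] with t ht using hpt t (hsub ht)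
    _ ≤ ∫ t in interval a b, C₂ * F t := by
        refine setIntegral_mono_set hFi ?_ (ae_of_all _ hsub)
        filter_upwards [ae_restrict_mem (measurableSet_interval a b)] with t ht
        exact (norm_nonneg _).trans (hpt t ht)

theorem tendsto_wronskian_weylDeriv (hH : IsSeparatedRealization a b q H)
    (hm : MainHypothesis a b q H φ χ) (hθ : IsFundamentalSystem a b q φ θ)
    (hM : IsSingularWeylFunction H φ θ M) {y : ℝ} (hy : y ∈ interval a b) {z : ℂ} {R : ℝ}
    (hR : 0 < R) (hRz : Metric.closedBall z R ⊆ resolventSet H) (j : ℕ) (w : ℂ)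
    {l : Filter ℝ} [l.IsCountablyGenerated] (hl : ∀ᶠ x in l, x ∈ interval a b) {g : ℂ → ℂ}
    (hg : ∀ ζ ∈ resolventSet H, Tendsto (wronskian (φ w) (χ ζ)) l (𝓝 (g ζ))) :
    Tendsto (wronskian (weylDeriv φ θ M j z) (φ w)) l
      (𝓝 (∮ ζ in C(z, R), weylKernel φ χ y z j ζ * -g ζ)) := by
  have hκ := continuousOn_weylKernel hH hm hθ hy hR hRz j
  obtain ⟨C, hC⟩ := exists_bound_wronskian hm hRz w
  obtain ⟨C', hC'⟩ := (isCompact_sphere z R).exists_bound_of_continuousOn hκ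
  have h := tendsto_circleIntegral (l := l)
    (G := fun ζ x => weylKernel φ χ y z j ζ * wronskian (χ ζ) (φ w) x)
    (g := fun ζ => weylKernel φ χ y z j ζ * -g ζ) (C := C' * C) hR.le
    (hl.mono fun x hx => hκ.mul (continuous_wronskian_right hm (φ w) hx).continuousOn)
    (hl.mono fun x hx ζ hζ => by
      rw [norm_mul]
      exact mul_le_mul (hC' ζ hζ) (hC x hx ζ hζ) (norm_nonneg _)
        ((norm_nonneg _).trans (hC' ζ hζ)))
    (fun ζ hζ => ((hg ζ (hRz (Metric.sphere_subset_closedBall hζ))).neg.congr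
      fun x => (wronskian_swap (φ w) (χ ζ) x).symm).const_mul _)
  exact h.congr' (hl.mono fun x hx =>
    (wronskian_weylDeriv_eq hH hm hθ hM hx hy hR hRz j (φ w)).symm)

/-- The limit at `b` of `W_x(ψ^{(j)}(z), φ(w))` is a multiple of `W(w)`. -/
theorem tendsto_wronskian_weylDeriv_right (hH : IsSeparatedRealization a b q H)
    (hm : MainHypothesis a b q H φ χ) (hθ : IsFundamentalSystem a b q φ θ)
    (hM : IsSingularWeylFunction H φ θ M) {y : ℝ} (hy : y ∈ interval a b) {z : ℂ} {R : ℝ}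
    (hR : 0 < R) (hRz : Metric.closedBall z R ⊆ resolventSet H) (j : ℕ) (w : ℂ) :
    Tendsto (wronskian (weylDeriv φ θ M j z) (φ w)) (toRight b)
      (𝓝 (∮ ζ in C(z, R), weylKernel φ χ y z j ζ * -wronskian (φ w) (χ w) y)) :=
  tendsto_wronskian_weylDeriv hH hm hθ hM hy hR hRz j w
    ((eventually_toRight hy).mono fun _ h => h.1) fun ζ hζ => hm.limit_right w ζ hζ y hy

/-- At `a`, the limit of `W_x(ψ(ζ), φ(w))` is `1` for every `ζ`, so that only `j = 0`
contributes. -/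
theorem tendsto_wronskian_weylDeriv_left (hH : IsSeparatedRealization a b q H)
    (hm : MainHypothesis a b q H φ χ) (hθ : IsFundamentalSystem a b q φ θ)
    (hM : IsSingularWeylFunction H φ θ M) {z : ℂ} {R : ℝ}
    (hR : 0 < R) (hRz : Metric.closedBall z R ⊆ resolventSet H) (j : ℕ) (w : ℂ) :
    Tendsto (wronskian (weylDeriv φ θ M j z) (φ w)) (toLeft a) (𝓝 (if j = 0 then 1 else 0)) := by
  obtain ⟨y, hy⟩ := nonempty_interval hm.interval_lt
  have h := tendsto_wronskian_weylDeriv hH hm hθ hM hy hR hRz j w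
    ((eventually_toLeft hy).mono fun _ h => h.1) fun ζ hζ => hm.limit_left w ζ hζ y hy
  convert h using 2
  have h1 := iteratedDeriv_eq_circleIntegral (z := z) hR (f := fun _ => (1 : ℂ))
    (differentiableOn_const _) j
  rw [iteratedDeriv_const] at h1
  rw [h1]
  refine circleIntegral.integral_congr hR.le fun ζ hζ => ?_
  have := wronskian_ne_zero hH hm hθ (hRz (Metric.sphere_subset_closedBall hζ)) hy
  simp only [weylKernel]
  field_simp

/-! ### The moment formula -/

/-- The fundamental theorem of calculus for a function with limits at both endpoints. -/
theorem integral_eq_sub_of_tendsto {a b : EReal} (hab : a < b) {V k : ℝ → ℂ} {A B : ℂ}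
    (hV : ∀ x ∈ interval a b, HasDerivAt V (k x) x) (hk : Integrable k (leb a b))
    (hA : Tendsto V (toLeft a) (𝓝 A)) (hB : Tendsto V (toRight b) (𝓝 B)) :
    ∫ x in interval a b, k x = B - A := by
  have := toLeft_neBot hab
  have := toRight_neBot hab
  refine tendsto_nhds_unique (tendsto_intervalIntegral hab hk)
    (((hB.comp tendsto_snd).sub (hA.comp tendsto_fst)).congr' ?_)
  filter_upwards [eventually_prod_interval hab] with p hp
  have hsub := uIcc_subset_interval hp.1 hp.2.1
  refine (intervalIntegral.integral_eq_sub_of_hasDerivAt (fun x hx => hV x (hsub hx)) ?_).symm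
  rw [intervalIntegrable_iff]
  exact IntegrableOn.mono_set hk (Set.uIoc_subset_uIcc.trans hsub)

/-- The Lagrange identity for `ψ^{(j)}(z)` and `φ(w)`, integrated over `(a, b)`. For `j = 0` the
truncated index `j - 1` has the coefficient `0`. -/
theorem integral_recursion (hH : IsSeparatedRealization a b q H)
    (hm : MainHypothesis a b q H φ χ) (hθ : IsFundamentalSystem a b q φ θ)
    (hM : IsSingularWeylFunction H φ θ M) {z : ℂ} {R : ℝ}
    (hR : 0 < R) (hRz : Metric.closedBall z R ⊆ resolventSet H) (w : ℂ) (j : ℕ) {B : ℂ}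
    (hB : Tendsto (wronskian (weylDeriv φ θ M j z) (φ w)) (toRight b) (𝓝 B)) :
    (z - w) * ∫ x in interval a b, φ w x * weylDeriv φ θ M j z x =
      B - (if j = 0 then 1 else 0) -
        j * ∫ x in interval a b, φ w x * weylDeriv φ θ M (j - 1) z x := by
  have hi := fun j => integrable_mul_weylDeriv hH hm hθ hM hR hRz j w
  have h := integral_eq_sub_of_tendsto hm.interval_lt
    (fun x hx => hasDerivAt_wronskian_weylDeriv hH hm hθ hM hx hR hRz j w)
    (((hi j).const_mul _).add ((hi (j - 1)).const_mul _))
    (tendsto_wronskian_weylDeriv_left hH hm hθ hM hR hRz j w) hB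
  rw [integral_add ((hi j).const_mul _) ((hi (j - 1)).const_mul _), integral_const_mul,
    integral_const_mul] at h
  linear_combination h

theorem integral_mul_weylDeriv (hH : IsSeparatedRealization a b q H)
    (hm : MainHypothesis a b q H φ χ) (hθ : IsFundamentalSystem a b q φ θ)
    (hM : IsSingularWeylFunction H φ θ M) {z : ℂ} {R : ℝ}
    (hR : 0 < R) (hRz : Metric.closedBall z R ⊆ resolventSet H) (w : ℂ) {B : ℕ → ℂ}
    (hB : ∀ k, Tendsto (wronskian (weylDeriv φ θ M k z) (φ w)) (toRight b) (𝓝 (B k))) (j : ℕ) :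
    (w - z) ^ (j + 1) / (j.factorial : ℂ) *
        ∫ x in interval a b, φ w x * weylDeriv φ θ M j z x
      = 1 - ∑ k ∈ Finset.range (j + 1), (w - z) ^ k / (k.factorial : ℂ) * B k := by
  induction j with
  | zero =>
    have h := integral_recursion hH hm hθ hM hR hRz w 0 (hB 0)
    simp only [if_true, Nat.cast_zero, zero_mul, sub_zero] at h
    simp only [zero_add, pow_one, Nat.factorial_zero, Nat.cast_one, div_one,
      Finset.sum_range_one, pow_zero, one_mul]
    linear_combination -h
  | succ j ih =>
    have h := integral_recursion hH hm hθ hM hR hRz w (j + 1) (hB (j + 1))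
    simp only [Nat.add_eq_zero_iff, one_ne_zero, and_false, if_false, sub_zero,
      Nat.add_sub_cancel] at h
    rw [Finset.sum_range_succ, ← sub_sub, ← ih]
    have hj : (j.factorial : ℂ) ≠ 0 := by exact_mod_cast j.factorial_ne_zero
    have hj1 : ((j + 1 : ℕ) : ℂ) ≠ 0 := by exact_mod_cast j.succ_ne_zero
    rw [Nat.factorial_succ, Nat.cast_mul]
    field_simp
    linear_combination (-(w - z) ^ (j + 1)) * h

end SingularWeyl

theorem mainTheorem9 (a b : EReal) (hab : a < b) (q : ℝ → ℝ)
    (hq : MeasureTheory.LocallyIntegrableOn q (SingularWeyl.interval a b))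
    (H : SingularWeyl.L2 a b →ₗ.[ℂ] SingularWeyl.L2 a b)
    (hH : SingularWeyl.IsSeparatedRealization a b q H)
    (φ χ θ : ℂ → ℝ → ℂ) (M : ℂ → ℂ)
    (hmain : SingularWeyl.MainHypothesis a b q H φ χ)
    (hθ : SingularWeyl.IsFundamentalSystem a b q φ θ)
    (hM : SingularWeyl.IsSingularWeylFunction H φ θ M) :
    -- the objects in the formula are well defined
    (∀ x ∈ SingularWeyl.interval a b, DifferentiableOn ℂ
        (fun z => SingularWeyl.weylSolution φ θ M z x) (SingularWeyl.resolventSet H)) ∧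
    (∀ z ∈ SingularWeyl.resolventSet H, ∀ j : ℕ, ∀ x ∈ SingularWeyl.interval a b,
        DifferentiableAt ℝ (SingularWeyl.weylDeriv φ θ M j z) x) ∧
    (∀ w : ℂ, ∀ z ∈ SingularWeyl.resolventSet H, ∀ j : ℕ, MeasureTheory.Integrable
        (fun x => φ w x * SingularWeyl.weylDeriv φ θ M j z x) (SingularWeyl.leb a b)) ∧
    -- the formula, with `B k` the limit at `b` of the Wronskian of `ψ^{(k)}(z)` and `φ(w)`
    (∀ w : ℂ, ∀ z ∈ SingularWeyl.resolventSet H, ∃ B : ℕ → ℂ,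
      (∀ k, Filter.Tendsto
        (SingularWeyl.wronskian (SingularWeyl.weylDeriv φ θ M k z) (φ w))
        (SingularWeyl.toRight b) (nhds (B k))) ∧
      ∀ j : ℕ,
        (w - z) ^ (j + 1) / (j.factorial : ℂ) *
            ∫ x in SingularWeyl.interval a b, φ w x * SingularWeyl.weylDeriv φ θ M j z x
          = 1 - ∑ k ∈ Finset.range (j + 1), (w - z) ^ k / (k.factorial : ℂ) * B k) ∧
    -- the consequence for the points of the spectrum
    (∀ l ∈ SingularWeyl.spectrum H, ∀ z ∈ SingularWeyl.resolventSet H, ∀ j : ℕ,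
      ∫ x in SingularWeyl.interval a b, φ l x * SingularWeyl.weylDeriv φ θ M j z x
        = (j.factorial : ℂ) / (l - z) ^ (j + 1)) := by
  have hopen := SingularWeyl.isOpen_resolventSet hH hmain hθ
  have hdisk : ∀ z ∈ SingularWeyl.resolventSet H,
      ∃ R > 0, Metric.closedBall z R ⊆ SingularWeyl.resolventSet H := fun z hz =>
    Metric.nhds_basis_closedBall.mem_iff.1 (hopen.mem_nhds hz)
  obtain ⟨y, hy⟩ := SingularWeyl.nonempty_interval hab
  refine ⟨fun x hx => SingularWeyl.differentiableOn_weylSolution hH hmain hθ hM hx,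
    fun z hz j x hx => ?_, fun w z hz j => ?_, fun w z hz => ?_, fun l hl z hz j => ?_⟩
  · obtain ⟨R, hR, hRz⟩ := hdisk z hz
    exact (SingularWeyl.hasDerivAt_weylDeriv hH hmain hθ hM hx hy hR hRz j).differentiableAt
  · obtain ⟨R, hR, hRz⟩ := hdisk z hz
    exact SingularWeyl.integrable_mul_weylDeriv hH hmain hθ hM hR hRz j w
  · obtain ⟨R, hR, hRz⟩ := hdisk z hz
    have hB := fun k =>
      SingularWeyl.tendsto_wronskian_weylDeriv_right hH hmain hθ hM hy hR hRz k w
    exact ⟨_, hB, SingularWeyl.integral_mul_weylDeriv hH hmain hθ hM hR hRz w hB⟩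
  · obtain ⟨R, hR, hRz⟩ := hdisk z hz
    -- On the spectrum `W(l) = 0`, so that all limits at `b` vanish.
    have hW : SingularWeyl.wronskian (φ l) (χ l) y = 0 :=
      SingularWeyl.wronskian_eq_zero_of_mem_spectrum hab hH hmain.discrete hl
        (hmain.entire_left.solution l) (hmain.entire_right.solution l) (hmain.near_left l)
        (hmain.near_right l) hy
    have hB : ∀ k, Tendsto (SingularWeyl.wronskian (SingularWeyl.weylDeriv φ θ M k z) (φ l))
        (SingularWeyl.toRight b) (𝓝 0) := fun k => by
      simpa [hW, circleIntegral] using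
        SingularWeyl.tendsto_wronskian_weylDeriv_right hH hmain hθ hM hy hR hRz k l
    have h := SingularWeyl.integral_mul_weylDeriv hH hmain hθ hM hR hRz l hB j
    have hlz : l - z ≠ 0 := fun h0 => hl (sub_eq_zero.1 h0 ▸ hz)
    have hj : (j.factorial : ℂ) ≠ 0 := by exact_mod_cast j.factorial_ne_zero
    simp only [mul_zero, Finset.sum_const_zero, sub_zero] at h
    rw [eq_div_iff (pow_ne_zero _ hlz)]
    field_simp at h
    linear_combination h
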